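/- Let $(G,\mathbf w)$ be a finite edge-weighted simple graph, i.e. a finite simple graph $G$ with vertex set $V(G)=\{1,\dots,n\}$ and edge set $E(G)$ together with a function $\mathbf w:E(G)\to\mathbb Z_{>0}$, and let $k$ be any field. Let $$I(G,\mathbf w)=\big((x_ix_j)^{\mathbf w(e)} : e=\{i,j\}\in E(G)\big)\subseteq k[x_1,\dots,x_n].$$ Then $I=I(G,\mathbf w)$ is normal, i.e. $I^t=\overline{I^t}$ for all $t\ge 1$, where $\overline{J}$ denotes the integral closure of an ideal $J$ (the set of all $r$ with $r^m+a_1r^{m-1}+\dots+a_m=0$ for some $m\ge1$ and $a_i\in J^i$), if and only if no induced edge-weighted subgraph of $(G,\mathbf w)$ (the subgraph of $G$ induced on some $U\subseteq V(G)$, with the weights of $\mathbf w$) is of one of the following forms $F_1,\dots,F_5$, in which a weight that is not mentioned is arbitrary and an odd cycle has length at least $3$: - $F_1$: a path with three vertices and two edges, both of weight $>1$. - $F_2$: a triangle with all three weights $>1$. - $F_3$: the disjoint union of two edges, both of weight $>1$ (so $U$ has four vertices and there are no other edges). - $F_4$: the disjoint union of an odd cycle and of an edge of weight $>1$ (the cycle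 has no chords, and there are no edges between the cycle and the edge). - $F_5$: a graph whose vertex set is the union of two disjoint sets, each of which induces an odd cycle (without chords), such that every edge between the two cycles, if there is any, has weight $>1$. -/

import Mathlib

/-- `r` is integral over the ideal `I`: it satisfies an equation
`r ^ n + a₁ * r ^ (n - 1) + ⋯ + aₙ = 0` with `n ≥ 1` and `aᵢ ∈ I ^ i` for `1 ≤ i ≤ n`. -/
def IsIntegralOverIdeal {R : Type*} [CommRing R] (I : Ideal R) (r : R) : Prop :=
  ∃ n : ℕ, 1 ≤ n ∧ ∃ a : ℕ → R, (∀ i ∈ Finset.Icc 1 n, a i ∈ I ^ i) ∧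
    r ^ n + ∑ i ∈ Finset.Icc 1 n, a i * r ^ (n - i) = 0

/-- The integral closure of the ideal `I` in its ring, as a set. -/
def idealIntegralClosure {R : Type*} [CommRing R] (I : Ideal R) : Set R :=
  {r | IsIntegralOverIdeal I r}

/-- The ideal `I` is normal: every power `I ^ t` with `t ≥ 1` equals its integral closure. -/
def IsNormalIdeal {R : Type*} [CommRing R] (I : Ideal R) : Prop :=
  ∀ t : ℕ, 1 ≤ t → ((I ^ t : Ideal R) : Set R) = idealIntegralClosure (I ^ t)

/-- A simple graph on the vertex set `V` with a positive integer weight on every edge. -/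
structure EdgeWeightedGraph (V : Type*) where
  graph : SimpleGraph V
  weight : graph.edgeSet → ℕ+

namespace EdgeWeightedGraph

/-- The edge ideal: it is generated by the `(x_i x_j) ^ w(e)`, for the edges `e = {i, j}`. -/
noncomputable def edgeIdeal (k : Type*) [Field k] {V : Type*} (G : EdgeWeightedGraph V) :
    Ideal (MvPolynomial V k) :=
  Ideal.span {m | ∃ (i j : V) (h : G.graph.Adj i j),
    m = (MvPolynomial.X i * MvPolynomial.X j) ^ (G.weight ⟨s(i, j), h⟩ : ℕ)}

/-- The induced edge-weighted subgraph on the set `s` of vertices. -/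
def induce {V : Type*} (G : EdgeWeightedGraph V) (s : Set V) : EdgeWeightedGraph s where
  graph := G.graph.induce s
  weight e := G.weight ((SimpleGraph.Embedding.induce s).mapEdgeSet e)

/-- The configuration `F₁`: a path with two edges, both of weight greater than one. -/
def IsF1 {W : Type*} (H : EdgeWeightedGraph W) : Prop :=
  Nonempty (H.graph ≃g SimpleGraph.pathGraph 3) ∧ ∀ e : H.graph.edgeSet, 1 < H.weight e

/-- The configuration `F₂`: a triangle with all weights greater than one. -/
def IsF2 {W : Type*} (H : EdgeWeightedGraph W) : Prop :=
  Nonempty (H.graph ≃g SimpleGraph.cycleGraph 3) ∧ ∀ e : H.graph.edgeSet, 1 < H.weight e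

/-- The configuration `F₃`: the disjoint union of two edges, both of weight greater than one. -/
def IsF3 {W : Type*} (H : EdgeWeightedGraph W) : Prop :=
  Nonempty (H.graph ≃g (SimpleGraph.pathGraph 2 ⊕g SimpleGraph.pathGraph 2)) ∧
    ∀ e : H.graph.edgeSet, 1 < H.weight e

/-- The configuration `F₄`: the disjoint union of an odd cycle (with arbitrary weights) and of
an edge of weight greater than one. -/
def IsF4 {W : Type*} (H : EdgeWeightedGraph W) : Prop :=
  ∃ k : ℕ, 1 ≤ k ∧
    ∃ φ : (SimpleGraph.cycleGraph (2 * k + 1) ⊕g SimpleGraph.pathGraph 2) ≃g H.graph,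
      ∀ h : H.graph.Adj (φ (Sum.inr 0)) (φ (Sum.inr 1)),
        1 < H.weight ⟨s(φ (Sum.inr 0), φ (Sum.inr 1)), h⟩

/-- The configuration `F₅`: the vertex set is split into the vertex sets of two odd cycles (with
arbitrary weights, and without chords); every edge between the two cycles, if there is any, has
weight greater than one. -/
def IsF5 {W : Type*} (H : EdgeWeightedGraph W) : Prop :=
  ∃ k l : ℕ, 1 ≤ k ∧ 1 ≤ l ∧ ∃ φ : Fin (2 * k + 1) ⊕ Fin (2 * l + 1) ≃ W,
    (∀ i j, H.graph.Adj (φ (Sum.inl i)) (φ (Sum.inl j)) ↔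
      (SimpleGraph.cycleGraph (2 * k + 1)).Adj i j) ∧
    (∀ i j, H.graph.Adj (φ (Sum.inr i)) (φ (Sum.inr j)) ↔
      (SimpleGraph.cycleGraph (2 * l + 1)).Adj i j) ∧
    ∀ i j, ∀ h : H.graph.Adj (φ (Sum.inl i)) (φ (Sum.inr j)),
      1 < H.weight ⟨s(φ (Sum.inl i), φ (Sum.inr j)), h⟩

end EdgeWeightedGraph

/-! Call an edge heavy if its weight exceeds one, and light otherwise. A real linear functional on
exponents defines a valuation, so separating a point from a closed convex set shows that every
exponent `b` of an element integral over `I ^ t` lies in the Newton polyhedron of `I ^ t`. After the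
substitution `y e = w e * c e`, this says that `b`, read as vertex capacities, admits a fractional
matching `y` with `∑ y e / w e = t`. Membership in `I ^ t` asks for an integral `c` with `∑ c e ≥ t`
such that the values `w e * c e` respect the same capacities. One direction is therefore a rounding
statement, `HasLightConnections.exists_packing`.

To round, take `y` that maximizes `∑ y e / w e`, then minimizes the total value of the heavy edges,
then has the fewest nonintegral values and loads. The last choice leaves no room for perturbation,
and a dimension count (`isOddTwoFactor_of_ker`) shows that the nonintegral edges form disjoint odd
cycles with half-integral values. Without the five configurations there is a light edge between any
two heavy edges, between an odd cycle and a heavy edge that misses it, and between two disjoint odd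
cycles. Exchanges along these light edges leave at most one heavy edge `g` in the support and at
most one cycle, which passes through `g` if both are present. Subtracting an alternating `± 1 / 2`
along the cycle, starting at an end of `g`, costs `1 / (2 * w g)`, and rounding `g` down to a
multiple of its weight costs at most `1 - 1 / w g`. The total loss is below one, so `t` survives.

For the converse, if a product of `2 * t` generators divides `x ^ (2 b)`, then `x ^ b` is integral
over `I ^ t`. For each configuration, a suitable `b` admits no `t` edges within its capacities. For
the cycles of `F₄` and `F₅` this is a parity count, after heavy edges on the cycles have been
excluded. -/

/-! ### Fractional matchings, lexicographic optima and perturbations -/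

section FractionalMatching

open scoped Classical
open Finset

variable {V E : Type*} [Fintype V] [Fintype E]

/-- The load that an edge function puts on the vertices: the sum over the incident edges. -/
noncomputable def vertexLoad (ends : E → Sym2 V) : (E → ℝ) →ₗ[ℝ] (V → ℝ) where
  toFun y v := ∑ e, if v ∈ ends e then y e else 0
  map_add' y z := by
    ext v
    simp only [Pi.add_apply, ← sum_add_distrib]
    exact sum_congr rfl fun e _ => by split_ifs <;> simp
  map_smul' c y := by
    ext v
    simp only [Pi.smul_apply, smul_eq_mul, RingHom.id_apply, mul_sum]
    exact sum_congr rfl fun e _ => by split_ifs <;> simp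

omit [Fintype V] in
theorem vertexLoad_apply (ends : E → Sym2 V) (y : E → ℝ) (v : V) :
    vertexLoad ends y v = ∑ e, if v ∈ ends e then y e else 0 := rfl

omit [Fintype V] in
theorem vertexLoad_eq_sum_filter (ends : E → Sym2 V) (y : E → ℝ) (v : V) :
    vertexLoad ends y v = ∑ e ∈ univ.filter (fun e => v ∈ ends e), y e := by
  rw [vertexLoad_apply, sum_filter]

omit [Fintype V] in
theorem vertexLoad_single (ends : E → Sym2 V) (e : E) (v : V) :
    vertexLoad ends (Pi.single e 1) v = if v ∈ ends e then 1 else 0 := by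
  rw [vertexLoad_apply, sum_eq_single e]
  · simp
  · intro f _ hf
    simp [hf]
  · simp

omit [Fintype V] in
theorem le_vertexLoad (ends : E → Sym2 V) {y : E → ℝ} (hy : 0 ≤ y) {e : E} {v : V}
    (hv : v ∈ ends e) : y e ≤ vertexLoad ends y v := by
  rw [vertexLoad_eq_sum_filter]
  exact single_le_sum (f := y) (fun f _ => hy f) (by simpa using hv)

theorem sum_mul_vertexLoad (ends : E → Sym2 V) (σ : V → ℝ) (y : E → ℝ) :
    ∑ v, σ v * vertexLoad ends y v = ∑ e, (∑ v, if v ∈ ends e then σ v else 0) * y e := by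
  simp only [vertexLoad_apply, mul_sum, sum_mul]
  rw [sum_comm]
  exact sum_congr rfl fun e _ => sum_congr rfl fun v _ => by split_ifs <;> simp

theorem sum_ite_mem_sym2 (σ : V → ℝ) {a b : V} (hab : a ≠ b) :
    (∑ v, if v ∈ s(a, b) then σ v else 0) = σ a + σ b := by
  rw [← sum_filter]
  have : univ.filter (fun v => v ∈ s(a, b)) = {a, b} := by
    ext v; simp
  rw [this, sum_pair hab]

theorem sum_vertexLoad {ends : E → Sym2 V} (hends : ∀ e, ¬ (ends e).IsDiag) (y : E → ℝ) :
    ∑ v, vertexLoad ends y v = 2 * ∑ e, y e := by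
  have h := sum_mul_vertexLoad ends (fun _ => 1) y
  simp only [one_mul] at h
  rw [h, mul_sum]
  refine sum_congr rfl fun e _ => ?_
  have he := hends e
  induction hs : ends e with
  | h a b =>
    rw [hs, Sym2.mk_isDiag_iff] at he
    rw [sum_ite_mem_sym2 (fun _ => (1 : ℝ)) he]
    norm_num

/-- Moving along a direction that vanishes at integral coordinates, until a further coordinate
becomes integral. -/
theorem exists_step_to_integral {ι : Type*} [Fintype ι] (x D : ι → ℝ) (hD : D ≠ 0)
    (hfr : ∀ i, D i ≠ 0 → Int.fract (x i) ≠ 0) :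
    ∃ s : ℝ, 0 < s ∧ (∀ i, (⌊x i⌋ : ℝ) ≤ x i + s * D i ∧ x i + s * D i ≤ ⌈x i⌉) ∧
      ∃ i, Int.fract (x i) ≠ 0 ∧ Int.fract (x i + s * D i) = 0 := by
  obtain ⟨j, hj⟩ := Function.ne_iff.mp hD
  -- The time at which coordinate `i` reaches the next integer in the direction of `D`; the smallest
  -- of these times is the step.
  let τ : ι → ℝ := fun i => if 0 < D i then (⌈x i⌉ - x i) / D i else (⌊x i⌋ - x i) / D i
  have hfl : ∀ i, D i ≠ 0 → (⌊x i⌋ : ℝ) < x i := fun i hi => by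
    have h1 := Int.floor_add_fract (x i)
    have h2 := (Int.fract_nonneg (x i)).lt_of_ne' (hfr i hi)
    linarith
  have hce : ∀ i, D i ≠ 0 → x i < ⌈x i⌉ := fun i hi => by
    refine (Int.le_ceil _).lt_of_ne fun h => hfr i hi ?_
    rw [h, Int.fract_intCast]
  have hτ : ∀ i, D i ≠ 0 → 0 < τ i := fun i hi => by
    simp only [τ]
    split_ifs with h
    · exact div_pos (by linarith [hce i hi]) h
    · exact div_pos_of_neg_of_neg (by linarith [hfl i hi]) (lt_of_le_of_ne (not_lt.mp h) hi)
  obtain ⟨m, hm, hmin⟩ := exists_min_image (univ.filter fun i => D i ≠ 0) τ ⟨j, by simpa using hj⟩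
  simp only [mem_filter, mem_univ, true_and] at hm hmin
  refine ⟨τ m, hτ m hm, fun i => ?_, m, hfr m hm, ?_⟩
  · by_cases hi : D i = 0
    · simp [hi, Int.floor_le, Int.le_ceil]
    have h1 := hmin i hi
    have h2 := hτ m hm
    rcases lt_or_gt_of_ne hi with h | h
    · have h3 : τ i * D i = ⌊x i⌋ - x i := by
        simp only [τ, if_neg h.not_gt]
        field_simp
      constructor
      · nlinarith
      · nlinarith [Int.le_ceil (x i)]
    · have h3 : τ i * D i = ⌈x i⌉ - x i := by
        simp only [τ, if_pos h]
        field_simp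
      constructor
      · nlinarith [Int.floor_le (x i)]
      · nlinarith
  · by_cases h : 0 < D m
    · have h3 : τ m * D m = ⌈x m⌉ - x m := by
        simp only [τ, if_pos h]
        field_simp
      rw [h3, add_sub_cancel, Int.fract_intCast]
    · have h3 : τ m * D m = ⌊x m⌋ - x m := by
        simp only [τ, if_neg h]
        field_simp
      rw [h3, add_sub_cancel, Int.fract_intCast]

/-- The edge functions that are nonnegative and respect the vertex capacities `a`. -/
def IsFeasible (ends : E → Sym2 V) (a : V → ℕ) (y : E → ℝ) : Prop :=
  0 ≤ y ∧ ∀ v, vertexLoad ends y v ≤ a v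

/-- The number of nonintegral edge values and nonintegral vertex loads. -/
noncomputable def fractCount (ends : E → Sym2 V) (y : E → ℝ) : ℕ :=
  (univ.filter fun i : E ⊕ V => Int.fract (Sum.elim y (vertexLoad ends y) i) ≠ 0).card

/-- Edge values and loads are treated as one family of coordinates. Zero and the capacities are
integers, so staying between the floor and the ceiling of every coordinate preserves feasibility.
Integral coordinates do not move, and one more becomes integral. -/
theorem IsFeasible.exists_step {ends : E → Sym2 V} {a : V → ℕ} {y d : E → ℝ}
    (hy : IsFeasible ends a y) (hd : d ≠ 0) (hd1 : ∀ e, d e ≠ 0 → Int.fract (y e) ≠ 0)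
    (hd2 : ∀ v, vertexLoad ends d v ≠ 0 → Int.fract (vertexLoad ends y v) ≠ 0) :
    ∃ s : ℝ, 0 < s ∧ IsFeasible ends a (y + s • d) ∧
      fractCount ends (y + s • d) < fractCount ends y := by
  obtain ⟨s, hs, h1, m, h2, h3⟩ := exists_step_to_integral (Sum.elim y (vertexLoad ends y))
    (Sum.elim d (vertexLoad ends d)) (fun h => hd (by
      ext e; simpa using congrFun h (Sum.inl e)))
    (by rintro (e | v); exacts [hd1 e, hd2 v])
  have hval : ∀ i, Sum.elim (y + s • d) (vertexLoad ends (y + s • d)) i =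
      Sum.elim y (vertexLoad ends y) i + s * Sum.elim d (vertexLoad ends d) i := by
    rintro (e | v) <;> simp
  refine ⟨s, hs, ⟨fun e => ?_, fun v => ?_⟩, ?_⟩
  · have := (h1 (Sum.inl e)).1
    have h0 : (0 : ℝ) ≤ ⌊y e⌋ := by exact_mod_cast Int.floor_nonneg.mpr (hy.1 e)
    simp only [Sum.elim_inl] at this
    simpa using h0.trans this
  · have := (h1 (Sum.inr v)).2
    have h0 : (⌈vertexLoad ends y v⌉ : ℝ) ≤ a v := by
      exact_mod_cast Int.ceil_le.mpr (by exact_mod_cast hy.2 v)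
    simp only [Sum.elim_inr] at this
    simpa using this.trans h0
  · refine card_lt_card ⟨fun i => ?_, fun h => ?_⟩
    · simp only [mem_filter, mem_univ, true_and, hval]
      intro hi h0
      by_cases hD : Sum.elim d (vertexLoad ends d) i = 0
      · rw [hD, mul_zero, add_zero] at hi
        exact hi h0
      · rcases i with e | v
        · exact hd1 e hD h0
        · exact hd2 v hD h0
    · have := h (mem_filter.mpr ⟨mem_univ m, h2⟩)
      simp only [mem_filter, mem_univ, true_and, hval] at this
      exact this h3

/-- `y` maximizes `obj` among the feasible functions and, among the maximizers, minimizes `pen`. -/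
structure IsLexOptimal (ends : E → Sym2 V) (a : V → ℕ) (obj pen : (E → ℝ) →ₗ[ℝ] ℝ)
    (y : E → ℝ) : Prop where
  feasible : IsFeasible ends a y
  obj_le : ∀ z, IsFeasible ends a z → obj z ≤ obj y
  pen_le : ∀ z, IsFeasible ends a z → obj z = obj y → pen y ≤ pen z

theorem isCompact_isFeasible {ends : E → Sym2 V} (a : V → ℕ) :
    IsCompact {y : E → ℝ | IsFeasible ends a y} := by
  have hcont : ∀ v, Continuous fun y : E → ℝ => vertexLoad ends y v := fun v =>
    (continuous_apply v).comp (LinearMap.continuous_of_finiteDimensional _)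
  refine (isCompact_Icc (a := (0 : E → ℝ)) (b := fun _ => ∑ v, (a v : ℝ))).of_isClosed_subset ?_ ?_
  · simp only [IsFeasible, Set.ofPred_and, Set.ofPred_forall]
    exact (isClosed_le continuous_const continuous_id).inter
      (isClosed_iInter fun v => isClosed_le (hcont v) continuous_const)
  · rintro y ⟨h0, h1⟩
    refine ⟨h0, fun e => ?_⟩
    obtain ⟨v, hv⟩ : ∃ v, v ∈ ends e := by
      induction ends e with
      | h a b => exact ⟨a, Sym2.mem_mk_left a b⟩
    exact ((le_vertexLoad ends h0 hv).trans (h1 v)).trans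
      (single_le_sum (f := fun v => (a v : ℝ)) (fun v _ => Nat.cast_nonneg _) (mem_univ v))

/-- Compactness gives the two nested optima. The count is a natural number, so it attains a minimum
among them. -/
theorem exists_isLexOptimal_minimal (ends : E → Sym2 V) (a : V → ℕ) (obj pen : (E → ℝ) →ₗ[ℝ] ℝ) :
    ∃ y, IsLexOptimal ends a obj pen y ∧
      ∀ z, IsLexOptimal ends a obj pen z → fractCount ends y ≤ fractCount ends z := by
  have ho : Continuous obj := LinearMap.continuous_of_finiteDimensional _
  have hp : Continuous pen := LinearMap.continuous_of_finiteDimensional _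
  have hK := isCompact_isFeasible (ends := ends) a
  obtain ⟨y₁, hy₁, hmax⟩ := hK.exists_isMaxOn ⟨0, le_rfl, fun v => by simp⟩ ho.continuousOn
  have hK' : IsCompact ({y : E → ℝ | IsFeasible ends a y} ∩ {y | obj y = obj y₁}) :=
    hK.inter_right (isClosed_eq ho continuous_const)
  obtain ⟨y₂, hy₂, hmin⟩ := hK'.exists_isMinOn ⟨y₁, hy₁, rfl⟩ hp.continuousOn
  have hex : ∃ n, ∃ y, IsLexOptimal ends a obj pen y ∧ fractCount ends y = n :=
    ⟨_, y₂, ⟨hy₂.1, fun z hz => (hmax hz).trans_eq hy₂.2.symm,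
      fun z hz hz' => hmin ⟨hz, hz'.trans hy₂.2⟩⟩, rfl⟩
  obtain ⟨y, hy, hn⟩ := Nat.find_spec hex
  exact ⟨y, hy, fun z hz => hn ▸ Nat.find_min' hex ⟨z, hz, rfl⟩⟩

omit [Fintype V] in
theorem IsLexOptimal.of_eq {ends : E → Sym2 V} {a : V → ℕ} {obj pen : (E → ℝ) →ₗ[ℝ] ℝ}
    {y z : E → ℝ} (hy : IsLexOptimal ends a obj pen y) (hz : IsFeasible ends a z)
    (h1 : obj z = obj y) (h2 : pen z = pen y) : IsLexOptimal ends a obj pen z :=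
  ⟨hz, fun u hu => h1 ▸ hy.obj_le u hu, fun u hu hu' => h2 ▸ hy.pen_le u hu (hu'.trans h1)⟩

omit [Fintype V] in
/-- No direction that stays feasible for a while keeps the objective and decreases the penalty. -/
theorem IsLexOptimal.not_improving {ends : E → Sym2 V} {a : V → ℕ} {obj pen : (E → ℝ) →ₗ[ℝ] ℝ}
    {y d : E → ℝ} (hy : IsLexOptimal ends a obj pen y) (hd : ∀ e, d e < 0 → 0 < y e)
    (hload : ∀ v, vertexLoad ends d v ≤ 0) (hobj : 0 ≤ obj d) : 0 ≤ pen d := by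
  obtain ⟨s, hs, hs'⟩ : ∃ s : ℝ, 0 < s ∧ ∀ e, 0 ≤ y e + s * d e := by
    have : ∀ e, ∃ s : ℝ, 0 < s ∧ ∀ r, 0 < r → r ≤ s → 0 ≤ y e + r * d e := fun e => by
      rcases lt_or_ge (d e) 0 with h | h
      · refine ⟨y e / (-d e), div_pos (hd e h) (by linarith), fun r hr hrs => ?_⟩
        rw [le_div_iff₀ (by linarith)] at hrs
        linarith
      · exact ⟨1, one_pos, fun r hr _ => add_nonneg (hy.feasible.1 e) (mul_nonneg hr.le h)⟩
    choose s hs hs' using this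
    rcases isEmpty_or_nonempty E with hE | hE
    · exact ⟨1, one_pos, fun e => hE.elim e⟩
    · obtain ⟨m, -, hm⟩ := exists_min_image univ s univ_nonempty
      exact ⟨s m, hs m, fun e => hs' e _ (hs m) (hm e (mem_univ e))⟩
  have hz : IsFeasible ends a (y + s • d) := by
    refine ⟨fun e => by simpa using hs' e, fun v => ?_⟩
    have h1 := hy.feasible.2 v
    have h2 := mul_nonpos_of_nonneg_of_nonpos hs.le (hload v)
    simp only [map_add, map_smul, Pi.add_apply, Pi.smul_apply, smul_eq_mul]
    linarith
  have h1 := hy.obj_le _ hz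
  simp only [map_add, map_smul, smul_eq_mul] at h1
  have h2 : obj (y + s • d) = obj y := by
    simp only [map_add, map_smul, smul_eq_mul]
    nlinarith [mul_nonneg hs.le hobj]
  have h3 := hy.pen_le _ hz h2
  simp only [map_add, map_smul, smul_eq_mul] at h3
  by_contra h
  nlinarith [mul_neg_of_pos_of_neg hs (not_le.mp h)]

/-- At a lexicographic optimum with the fewest nonintegral values, a perturbation of the
nonintegral edge values that changes only nonintegral loads is zero. -/
theorem IsLexOptimal.eq_zero_of_minimal {ends : E → Sym2 V} {a : V → ℕ}
    {obj pen : (E → ℝ) →ₗ[ℝ] ℝ} {y d : E → ℝ} (hy : IsLexOptimal ends a obj pen y)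
    (hmin : ∀ z, IsLexOptimal ends a obj pen z → fractCount ends y ≤ fractCount ends z)
    (hd1 : ∀ e, d e ≠ 0 → Int.fract (y e) ≠ 0)
    (hd2 : ∀ v, vertexLoad ends d v ≠ 0 → Int.fract (vertexLoad ends y v) ≠ 0) : d = 0 := by
  by_contra hd
  -- Steps along both `d` and `-d` are possible, so optimality forces `obj d = 0` and then `pen d =
  -- 0`; the step along `d` is then again optimal, with a smaller count.
  obtain ⟨s, hs, hf, hlt⟩ := hy.feasible.exists_step hd hd1 hd2
  obtain ⟨r, hr, hf', -⟩ := hy.feasible.exists_step (d := -d) (neg_ne_zero.mpr hd)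
    (fun e he => hd1 e (by simpa using he)) (fun v hv => hd2 v (by simpa using hv))
  have h1 := hy.obj_le _ hf
  have h2 := hy.obj_le _ hf'
  simp only [map_add, map_smul, map_neg, smul_eq_mul] at h1 h2
  have h3 : obj d = 0 := by
    refine le_antisymm ?_ ?_
    · by_contra h; nlinarith [mul_pos hs (not_le.mp h)]
    · by_contra h; nlinarith [mul_pos hr (neg_pos.mpr (not_le.mp h))]
  have h4 := hy.pen_le _ hf (by simp [h3])
  have h5 := hy.pen_le _ hf' (by simp [h3])
  simp only [map_add, map_smul, map_neg, smul_eq_mul] at h4 h5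
  have h6 : pen d = 0 := by
    refine le_antisymm ?_ ?_
    · by_contra h; nlinarith [mul_pos hr (not_le.mp h)]
    · by_contra h; nlinarith [mul_pos hs (neg_pos.mpr (not_le.mp h))]
  exact (hmin _ (hy.of_eq hf (by simp [h3]) (by simp [h6]))).not_gt hlt

end FractionalMatching

/-! ### Odd two-factors from a dimension count -/

section TwoRegular

open scoped Classical
open Finset

variable {V E : Type*} [Fintype V] [Fintype E]

omit [Fintype V] in
theorem vertexLoad_ne_zero {ends : E → Sym2 V} {d : E → ℝ} {v : V} (h : vertexLoad ends d v ≠ 0) :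
    ∃ e, d e ≠ 0 ∧ v ∈ ends e := by
  rw [vertexLoad_eq_sum_filter] at h
  obtain ⟨e, he, h0⟩ := exists_ne_zero_of_sum_ne_zero h
  exact ⟨e, h0, (mem_filter.mp he).2⟩

/-- A set of edges that forms vertex-disjoint odd cycles, expressed by linear algebra: every vertex
it covers is on exactly two of its edges, and the edge functions supported on it correspond to the
functions on the covered vertices. -/
structure IsOddTwoFactor (ends : E → Sym2 V) (F : Finset E) : Prop where
  degree_two : ∀ v, (∃ e ∈ F, v ∈ ends e) →
    ∃ e f, e ≠ f ∧ F.filter (fun e => v ∈ ends e) = {e, f}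
  eq_zero : ∀ d : E → ℝ, (∀ e, d e ≠ 0 → e ∈ F) → vertexLoad ends d = 0 → d = 0
  exists_load : ∀ v, (∃ e ∈ F, v ∈ ends e) →
    ∃ d : E → ℝ, (∀ e, d e ≠ 0 → e ∈ F) ∧ vertexLoad ends d = Pi.single v 1

theorem sum_card_filter_mem {ends : E → Sym2 V} (hends : ∀ e, ¬ (ends e).IsDiag) (F : Finset E) :
    ∑ v, (F.filter fun e => v ∈ ends e).card = 2 * F.card := by
  have h := sum_vertexLoad hends (fun e => if e ∈ F then (1 : ℝ) else 0)
  have h1 : ∀ v, vertexLoad ends (fun e => if e ∈ F then (1 : ℝ) else 0) v =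
      ((F.filter fun e => v ∈ ends e).card : ℝ) := fun v => by
    rw [vertexLoad_eq_sum_filter, sum_ite, sum_const_zero, add_zero, sum_const, nsmul_eq_mul,
      mul_one]
    congr 2
    ext e
    simp [and_comm]
  simp only [h1] at h
  rw [sum_ite, sum_const_zero, add_zero, sum_const, nsmul_eq_mul, mul_one, filter_mem_eq_inter,
    univ_inter] at h
  exact_mod_cast h

/-- The loads at the covered vertices outside `Z` determine a function supported on `F`, so `F` has
at most as many edges as there are such vertices. Each of these has degree at least two in `F`, and
each covered vertex of `Z` at least one, so the handshake identity turns every inequality into an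
equality. Hence no vertex of `Z` is covered, all degrees are two, and the injective load map is
bijective, which yields `exists_load`. Injectivity is what excludes even cycles, where alternating
signs have zero load. -/
theorem isOddTwoFactor_of_ker {ends : E → Sym2 V} (hends : ∀ e, ¬ (ends e).IsDiag) (F : Finset E)
    (Z : Set V)
    (hdeg : ∀ v, v ∉ Z → (∃ e ∈ F, v ∈ ends e) → 2 ≤ (F.filter fun e => v ∈ ends e).card)
    (hker : ∀ d : E → ℝ, (∀ e, d e ≠ 0 → e ∈ F) → (∀ v, vertexLoad ends d v ≠ 0 → v ∈ Z) → d = 0) :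
    IsOddTwoFactor ends F ∧ ∀ v, (∃ e ∈ F, v ∈ ends e) → v ∉ Z := by
  set W : Finset V := univ.filter fun v => ∃ e ∈ F, v ∈ ends e with hW
  set W' : Finset V := W.filter fun v => v ∉ Z with hW'
  let ext : (F → ℝ) →ₗ[ℝ] (E → ℝ) := Function.ExtendByZero.linearMap ℝ (Subtype.val : F → E)
  have hext : ∀ x : F → ℝ, ∀ e, ext x e ≠ 0 → e ∈ F := fun x e he => by
    by_contra h
    refine he (Function.extend_apply' _ _ _ ?_)
    rintro ⟨e', rfl⟩
    exact h e'.2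
  have hext' : ∀ x : F → ℝ, ∀ e : F, ext x e = x e := fun x e =>
    Subtype.val_injective.extend_apply _ _ _
  have hcov : ∀ x : F → ℝ, ∀ v, vertexLoad ends (ext x) v ≠ 0 → v ∈ W := fun x v hv => by
    obtain ⟨e, he, hve⟩ := vertexLoad_ne_zero hv
    exact mem_filter.mpr ⟨mem_univ _, e, hext x e he, hve⟩
  let L : (F → ℝ) →ₗ[ℝ] (W' → ℝ) :=
    (LinearMap.funLeft ℝ ℝ (Subtype.val : W' → V)).comp ((vertexLoad ends).comp ext)
  have hL : ∀ x (v : W'), L x v = vertexLoad ends (ext x) v := fun x v => rfl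
  have hinj : Function.Injective L := by
    rw [← LinearMap.ker_eq_bot, LinearMap.ker_eq_bot']
    intro x hx
    have h0 : ext x = 0 := by
      refine hker _ (hext x) fun v hv => ?_
      by_contra hZ
      refine hv ?_
      rw [← hL x ⟨v, mem_filter.mpr ⟨hcov x v hv, hZ⟩⟩, hx]
      rfl
    funext e
    rw [← hext' x e, h0]
    rfl
  have hcard : F.card ≤ W'.card := by
    have := LinearMap.finrank_le_finrank_of_injective hinj
    simpa using this
  have hsum : ∑ v ∈ W, (F.filter fun e => v ∈ ends e).card = 2 * F.card := by
    rw [← sum_card_filter_mem hends F]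
    refine sum_subset (subset_univ _) fun v _ hv => ?_
    rw [card_eq_zero, filter_eq_empty_iff]
    exact fun e he hve => hv (mem_filter.mpr ⟨mem_univ _, e, he, hve⟩)
  have hsplit : ∑ v ∈ W', (F.filter fun e => v ∈ ends e).card +
      ∑ v ∈ W.filter (fun v => ¬ v ∉ Z), (F.filter fun e => v ∈ ends e).card =
      ∑ v ∈ W, (F.filter fun e => v ∈ ends e).card :=
    sum_filter_add_sum_filter_not W (fun v => v ∉ Z) _
  have h1 : ∑ v ∈ W', 2 ≤ ∑ v ∈ W', (F.filter fun e => v ∈ ends e).card :=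
    sum_le_sum fun v hv => by
      rw [hW', mem_filter, hW, mem_filter] at hv
      exact hdeg v hv.2 hv.1.2
  have h2 : ∑ v ∈ W.filter (fun v => ¬ v ∉ Z), 1 ≤
      ∑ v ∈ W.filter (fun v => ¬ v ∉ Z), (F.filter fun e => v ∈ ends e).card :=
    sum_le_sum fun v hv => by
      rw [mem_filter, hW, mem_filter] at hv
      obtain ⟨e, he, hve⟩ := hv.1.2
      exact card_pos.mpr ⟨e, mem_filter.mpr ⟨he, hve⟩⟩
  have h1' := h1
  rw [sum_const, smul_eq_mul] at h1 h2
  rw [hsum] at hsplit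
  have hZ0 : (W.filter fun v => ¬ v ∉ Z).card = 0 := by omega
  have hcardW : F.card = W'.card := by omega
  have hnZ : ∀ v, (∃ e ∈ F, v ∈ ends e) → v ∉ Z := fun v hv hvZ => by
    rw [card_eq_zero, filter_eq_empty_iff] at hZ0
    exact hZ0 (mem_filter.mpr ⟨mem_univ _, hv⟩) (not_not.mpr hvZ)
  have hmem : ∀ v, (∃ e ∈ F, v ∈ ends e) → v ∈ W' := fun v hv =>
    mem_filter.mpr ⟨mem_filter.mpr ⟨mem_univ _, hv⟩, hnZ v hv⟩
  have heq := (sum_eq_sum_iff_of_le (s := W') (f := fun _ => 2)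
    (g := fun v => (F.filter fun e => v ∈ ends e).card) (fun v hv => by
      rw [hW', mem_filter, hW, mem_filter] at hv
      exact hdeg v hv.2 hv.1.2)).mp (by rw [sum_const, smul_eq_mul]; omega)
  refine ⟨⟨fun v hv => ?_, fun d hd h0 => hker d hd fun v hv => absurd (congrFun h0 v) hv,
    fun v hv => ?_⟩, hnZ⟩
  · exact card_eq_two.mp (heq v (hmem v hv)).symm
  · have hsurj := (LinearMap.injective_iff_surjective_of_finrank_eq_finrank (f := L)
      (by simp [hcardW])).mp hinj
    obtain ⟨x, hx⟩ := hsurj (Pi.single ⟨v, hmem v hv⟩ 1)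
    refine ⟨ext x, hext x, ?_⟩
    funext u
    by_cases hu : u ∈ W'
    · rw [← hL x ⟨u, hu⟩, hx]
      by_cases huv : u = v
      · subst huv; simp
      · rw [Pi.single_eq_of_ne huv, Pi.single_eq_of_ne (fun h => huv (congrArg Subtype.val h))]
    · have huv : u ≠ v := fun h => hu (h ▸ hmem v hv)
      rw [Pi.single_eq_of_ne huv]
      by_contra h
      exact hu (hmem u (mem_filter.mp (hcov x u h)).2)

namespace IsOddTwoFactor

variable {ends : E → Sym2 V} {F : Finset E}

omit [Fintype V] in
theorem load_eq {v : V} {e f : E} (hef : e ≠ f) (hF : F.filter (fun e => v ∈ ends e) = {e, f})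
    {d : E → ℝ} (hd : ∀ e, d e ≠ 0 → e ∈ F) : vertexLoad ends d v = d e + d f := by
  rw [vertexLoad_eq_sum_filter, ← sum_pair hef, ← hF]
  refine (sum_subset (fun e he => ?_) fun e he he' => ?_).symm
  · exact mem_filter.mpr ⟨mem_univ _, (mem_filter.mp he).2⟩
  · by_contra h
    exact he' (mem_filter.mpr ⟨hd e h, (mem_filter.mp he).2⟩)

omit [Fintype V] in
theorem eq_of_load_eq (h : IsOddTwoFactor ends F) {d d' : E → ℝ} (hd : ∀ e, d e ≠ 0 → e ∈ F)
    (hd' : ∀ e, d' e ≠ 0 → e ∈ F) (hl : vertexLoad ends d = vertexLoad ends d') : d = d' := by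
  refine sub_eq_zero.mp (h.eq_zero _ (fun e he => ?_) (by rw [map_sub, hl, sub_self]))
  by_contra hF
  have h1 : d e = 0 := by_contra fun h => hF (hd e h)
  have h2 : d' e = 0 := by_contra fun h => hF (hd' e h)
  exact he (by simp [h1, h2])

omit [Fintype V] in
/-- If the values outside `F` and the loads at the vertices of `F` are integral and the values on
`F` are not, then the latter are half-integral. -/
theorem fract_eq_half (h : IsOddTwoFactor ends F) {y : E → ℝ}
    (hy : ∀ e, e ∈ F ↔ Int.fract (y e) ≠ 0)
    (hint : ∀ v, (∃ e ∈ F, v ∈ ends e) → Int.fract (vertexLoad ends y v) = 0) {e₀ : E}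
    (he₀ : e₀ ∈ F) : Int.fract (y e₀) = 1 / 2 := by
  set α := Int.fract (y e₀) with hα
  by_contra hne
  have hneg : α ≠ 1 - α := fun h => hne (by linarith)
  -- The two fractional parts at a covered vertex add up to one, so `α` and `1 - α` alternate. If
  -- they differ, these signs have zero load everywhere, contrary to `eq_zero`.
  let s : E → ℝ := fun e => if Int.fract (y e) = α then 1 else
    if Int.fract (y e) = 1 - α then -1 else 0
  have hα0 : α ≠ 0 := (hy e₀).mp he₀
  have hα1 : 1 - α ≠ 0 := by
    have := Int.fract_lt_one (y e₀)
    rw [← hα] at this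
    linarith
  have hs : ∀ e, s e ≠ 0 → e ∈ F := fun e he => by
    rw [hy]
    intro h0
    refine he ?_
    simp only [s, h0, if_neg hα0.symm, if_neg hα1.symm]
  have hsl : vertexLoad ends s = 0 := by
    funext v
    by_cases hv : ∃ e ∈ F, v ∈ ends e
    · obtain ⟨e, f, hef, hF⟩ := h.degree_two v hv
      rw [load_eq hef hF hs]
      have hsum : Int.fract (y e) + Int.fract (y f) = 1 := by
        have heF : e ∈ F := (mem_filter.mp (hF ▸ mem_insert_self e {f})).1
        have hfF : f ∈ F := (mem_filter.mp (hF ▸ mem_insert_of_mem (mem_singleton_self f))).1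
        have h1 := (Int.fract_nonneg (y e)).lt_of_ne' ((hy e).mp heF)
        have h2 := (Int.fract_nonneg (y f)).lt_of_ne' ((hy f).mp hfF)
        have h3 := Int.fract_lt_one (y e)
        have h4 := Int.fract_lt_one (y f)
        have hload : vertexLoad ends (fun e => Int.fract (y e)) v =
            Int.fract (y e) + Int.fract (y f) :=
          load_eq hef hF fun e he => (hy e).mpr he
        have hload' : vertexLoad ends (fun e => Int.fract (y e)) v =
            (⌊vertexLoad ends y v⌋ - ∑ e, if v ∈ ends e then ⌊y e⌋ else 0 : ℤ) := by
          have h5 := Int.floor_add_fract (vertexLoad ends y v)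
          rw [hint v hv, add_zero] at h5
          push_cast
          rw [h5, vertexLoad_apply, vertexLoad_apply, ← sum_sub_distrib]
          refine sum_congr rfl fun e _ => ?_
          split_ifs
          · exact (Int.self_sub_floor _).symm
          · simp
        have h5 := hload.symm.trans hload'
        set n : ℤ := ⌊vertexLoad ends y v⌋ - ∑ e, if v ∈ ends e then ⌊y e⌋ else 0
        have h6 : (0 : ℝ) < n := by linarith
        have h7 : (n : ℝ) < 2 := by linarith
        have h8 : 0 < n := by exact_mod_cast h6
        have h9 : n < 2 := by exact_mod_cast h7
        have : n = 1 := by omega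
        rw [h5, this]; norm_num
      have hf : Int.fract (y f) = 1 - Int.fract (y e) := by linarith
      simp only [s, hf, Pi.zero_apply]
      by_cases h1 : Int.fract (y e) = α
      · rw [if_pos h1, h1, if_neg hneg.symm, if_pos rfl]; norm_num
      · rw [if_neg h1]
        by_cases h2 : Int.fract (y e) = 1 - α
        · rw [if_pos h2, h2, if_pos (by ring)]; norm_num
        · rw [if_neg h2, if_neg (fun h => h2 (by linarith)), if_neg (fun h => h1 (by linarith))]
          norm_num
    · by_contra hne
      obtain ⟨e, he, hve⟩ := vertexLoad_ne_zero hne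
      exact hv ⟨e, hs e he, hve⟩
  have := congrFun (h.eq_zero s hs hsl) e₀
  simp [s, ← hα] at this

/-- The edge function supported on `F` whose load is one at `v` and zero elsewhere. -/
noncomputable def vertexPotential (h : IsOddTwoFactor ends F) (v : V) : E → ℝ :=
  if hv : ∃ e ∈ F, v ∈ ends e then (h.exists_load v hv).choose else 0

omit [Fintype V] in
theorem vertexPotential_support (h : IsOddTwoFactor ends F) {v : V} {e : E}
    (he : h.vertexPotential v e ≠ 0) : e ∈ F := by
  unfold vertexPotential at he
  split_ifs at he with hv
  · exact (h.exists_load v hv).choose_spec.1 e he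
  · exact absurd rfl he

omit [Fintype V] in
theorem vertexLoad_vertexPotential (h : IsOddTwoFactor ends F) {v : V}
    (hv : ∃ e ∈ F, v ∈ ends e) : vertexLoad ends (h.vertexPotential v) = Pi.single v 1 := by
  unfold vertexPotential
  rw [dif_pos hv]
  exact (h.exists_load v hv).choose_spec.2

/-- By the handshake identity, a unit of load at `v` is worth one half in total edge value. In the
exchanges this is compared with the at most one half that a unit on a heavy edge is worth. -/
theorem sum_vertexPotential (h : IsOddTwoFactor ends F) (hends : ∀ e, ¬ (ends e).IsDiag) {v : V}
    (hv : ∃ e ∈ F, v ∈ ends e) : ∑ e, h.vertexPotential v e = 1 / 2 := by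
  have := sum_vertexLoad hends (h.vertexPotential v)
  rw [h.vertexLoad_vertexPotential hv, sum_pi_single', if_pos (mem_univ v)] at this
  linarith

end IsOddTwoFactor

end TwoRegular

/-! ### The cycles of an odd two-factor, as supports of potentials -/

section OddComponents

open scoped Classical
open Finset

variable {V E : Type*} [Fintype V] [Fintype E]

/-- The edges inside `U` do not form a bipartite graph. -/
def IsOddSet (ends : E → Sym2 V) (U : Set V) : Prop :=
  ¬ ∃ σ : V → Bool, ∀ e a b, ends e = s(a, b) → a ∈ U → b ∈ U → σ a ≠ σ b

namespace IsOddTwoFactor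

variable {ends : E → Sym2 V} {F : Finset E}

omit [Fintype V] [Fintype E] in
theorem mem_pair {u : V} {e e' f' : E} (hF : F.filter (fun e => u ∈ ends e) = {e', f'})
    (he : e ∈ F) (hu : u ∈ ends e) : e = e' ∨ e = f' := by
  have : e ∈ F.filter (fun e => u ∈ ends e) := mem_filter.mpr ⟨he, hu⟩
  simpa [hF] using this

omit [Fintype V] [Fintype E] in
theorem pair_mem {u : V} {e f : E} (hF : F.filter (fun e => u ∈ ends e) = {e, f}) :
    (e ∈ F ∧ u ∈ ends e) ∧ f ∈ F ∧ u ∈ ends f :=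
  ⟨mem_filter.mp (hF ▸ mem_insert_self e {f}),
    mem_filter.mp (hF ▸ mem_insert_of_mem (mem_singleton_self f))⟩

omit [Fintype V] in
/-- Restricting to the edges with a given absolute value keeps the loads zero away from `v`. -/
theorem vertexLoad_abs_eq (h : IsOddTwoFactor ends F) {v : V} (hv : ∃ e ∈ F, v ∈ ends e) (r : ℝ)
    {u : V} (hu : u ≠ v) :
    vertexLoad ends (fun e => if |h.vertexPotential v e| = r then h.vertexPotential v e else 0) u
      = 0 := by
  have hsupp : ∀ e, (if |h.vertexPotential v e| = r then h.vertexPotential v e else 0) ≠ 0 →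
      e ∈ F := fun e he => h.vertexPotential_support (v := v) (by
    split_ifs at he
    · exact he
    · exact absurd rfl he)
  by_cases hc : ∃ e ∈ F, u ∈ ends e
  · obtain ⟨e, f, hef, hF⟩ := h.degree_two u hc
    have h0 := load_eq hef hF (fun e he => h.vertexPotential_support (v := v) he)
    rw [h.vertexLoad_vertexPotential hv, Pi.single_eq_of_ne hu] at h0
    have hf : h.vertexPotential v f = -h.vertexPotential v e := by linarith
    rw [load_eq hef hF hsupp]
    simp only [hf, abs_neg]
    split_ifs <;> simp
  · by_contra hne
    obtain ⟨e, he, hue⟩ := vertexLoad_ne_zero hne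
    exact hc ⟨e, hsupp e he, hue⟩

/-- The two values at `v` add up to one, so it is enough that their absolute values agree. If they
did not, the part of the potential of absolute value `|d e|` would be a multiple of the whole
potential. That forces `d e = 1` and integral values, although their sum is `1 / 2`. -/
theorem vertexPotential_eq_half_of_ne_zero (h : IsOddTwoFactor ends F)
    (hends : ∀ e, ¬ (ends e).IsDiag) {v : V} {e f : E} (hef : e ≠ f)
    (hF : F.filter (fun e => v ∈ ends e) = {e, f}) (he : h.vertexPotential v e ≠ 0) :
    h.vertexPotential v e = 1 / 2 := by
  have hv : ∃ e ∈ F, v ∈ ends e := ⟨e, (pair_mem hF).1⟩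
  have h0 := load_eq hef hF (fun e he => h.vertexPotential_support (v := v) he)
  rw [h.vertexLoad_vertexPotential hv, Pi.single_eq_same] at h0
  set d := h.vertexPotential v with hd
  by_contra hne
  have habs : |d f| ≠ |d e| := fun habs => by
    rcases abs_eq_abs.mp habs with h1 | h1
    · exact hne (by linarith)
    · linarith
  have hsupp : ∀ g, (if |d g| = |d e| then d g else 0) ≠ 0 → g ∈ F := fun g hg =>
    h.vertexPotential_support (v := v) (by
      split_ifs at hg
      · exact hg
      · exact absurd rfl hg)
  -- Both sides have load `d e` at `v` and zero elsewhere, since `f` drops out of the restriction.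
  have hkey : (fun g => if |d g| = |d e| then d g else 0) = d e • d := by
    refine h.eq_of_load_eq hsupp (fun g hg => h.vertexPotential_support (v := v) fun h0 => hg ?_) ?_
    · simp [← hd] at h0
      simp [h0]
    · rw [map_smul, hd, h.vertexLoad_vertexPotential hv, ← hd]
      funext u
      by_cases hu : u = v
      · subst hu
        rw [load_eq hef hF hsupp]
        simp [habs]
      · rw [hd, h.vertexLoad_abs_eq hv _ hu]
        simp [hu]
  have h1 : d e = 1 := by
    have := congrFun hkey e
    simp only [if_true, Pi.smul_apply, smul_eq_mul] at this
    field_simp at this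
    linarith
  have hsum := h.sum_vertexPotential hends hv
  rw [← hd] at hsum
  have hint : ∀ g, ∃ n : ℤ, d g = n := fun g => by
    have := congrFun hkey g
    simp only [h1, one_smul] at this
    split_ifs at this with h2
    · rcases abs_eq (by norm_num) |>.mp (h2.trans (abs_one)) with h3 | h3
      · exact ⟨1, by simpa using h3⟩
      · exact ⟨-1, by simpa using h3⟩
    · exact ⟨0, by simpa using this.symm⟩
  choose n hn using hint
  simp only [hn] at hsum
  have h2 : (2 * ∑ g, n g : ℤ) = (1 : ℤ) := by
    have : (2 * ∑ g, (n g : ℝ)) = 1 := by linarith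
    exact_mod_cast this
  omega

theorem vertexPotential_eq_half (h : IsOddTwoFactor ends F) (hends : ∀ e, ¬ (ends e).IsDiag)
    {v : V} {e : E} (he : e ∈ F) (hv : v ∈ ends e) : h.vertexPotential v e = 1 / 2 := by
  obtain ⟨e', f', hef, hF⟩ := h.degree_two v ⟨e, he, hv⟩
  have h0 := load_eq hef hF (fun e he => h.vertexPotential_support (v := v) he)
  rw [h.vertexLoad_vertexPotential ⟨e, he, hv⟩, Pi.single_eq_same] at h0
  have hF' : F.filter (fun e => v ∈ ends e) = {f', e'} := by rw [hF, pair_comm]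
  by_cases h1 : h.vertexPotential v e' = 0
  · have h2 := h.vertexPotential_eq_half_of_ne_zero hends hef.symm hF' (by
      intro h3
      rw [h1, h3] at h0
      norm_num at h0)
    rw [h1, h2] at h0
    norm_num at h0
  · have h2 := h.vertexPotential_eq_half_of_ne_zero hends hef hF h1
    rcases mem_pair hF he hv with rfl | rfl
    · exact h2
    · rw [h2] at h0
      linarith

/-- The part of absolute value `1 / 2` contains both edges at `v`, hence has the same load as the
whole potential and equals it. -/
theorem abs_vertexPotential (h : IsOddTwoFactor ends F) (hends : ∀ e, ¬ (ends e).IsDiag)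
    {v : V} {e : E} (he : h.vertexPotential v e ≠ 0) : |h.vertexPotential v e| = 1 / 2 := by
  have hv : ∃ e ∈ F, v ∈ ends e := by
    by_contra hv
    refine he ?_
    rw [vertexPotential, dif_neg hv]
    rfl
  obtain ⟨e', f', hef, hF⟩ := h.degree_two v hv
  have hhalf : |(1 / 2 : ℝ)| = 1 / 2 := abs_of_pos (by norm_num)
  have he' := h.vertexPotential_eq_half hends (pair_mem hF).1.1 (pair_mem hF).1.2
  have hf' := h.vertexPotential_eq_half hends (pair_mem hF).2.1 (pair_mem hF).2.2
  have hsupp : ∀ g, (if |h.vertexPotential v g| = 1 / 2 then h.vertexPotential v g else 0) ≠ 0 →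
      g ∈ F := fun g hg => h.vertexPotential_support (v := v) (by
    split_ifs at hg
    · exact hg
    · exact absurd rfl hg)
  have hkey := h.eq_of_load_eq hsupp (fun g hg => h.vertexPotential_support (v := v) hg) (by
    rw [h.vertexLoad_vertexPotential hv]
    funext u
    by_cases hu : u = v
    · subst hu
      rw [load_eq hef hF hsupp, he', hf', if_pos hhalf, Pi.single_eq_same]
      norm_num
    · rw [h.vertexLoad_abs_eq hv _ hu, Pi.single_eq_of_ne hu])
  have := congrFun hkey e
  by_contra hne
  rw [if_neg hne] at this
  exact he this.symm

/-- The vertices of the cycle through `v`. -/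
def component (h : IsOddTwoFactor ends F) (v : V) : Set V :=
  {u | ∃ e, h.vertexPotential v e ≠ 0 ∧ u ∈ ends e}

omit [Fintype V] in
theorem covered_of_mem_component (h : IsOddTwoFactor ends F) {u v : V} (hu : u ∈ h.component v) :
    ∃ e ∈ F, u ∈ ends e := by
  obtain ⟨e, he, hue⟩ := hu
  exact ⟨e, h.vertexPotential_support he, hue⟩

omit [Fintype V] in
theorem covered_of_ne_zero (h : IsOddTwoFactor ends F) {v : V} {e : E}
    (he : h.vertexPotential v e ≠ 0) : ∃ e ∈ F, v ∈ ends e := by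
  by_contra hv
  refine he ?_
  rw [vertexPotential, dif_neg hv]
  rfl

theorem mem_component_self (h : IsOddTwoFactor ends F) (hends : ∀ e, ¬ (ends e).IsDiag) {v : V}
    (hv : ∃ e ∈ F, v ∈ ends e) : v ∈ h.component v := by
  obtain ⟨e, he, hve⟩ := hv
  refine ⟨e, ?_, hve⟩
  rw [h.vertexPotential_eq_half hends he hve]
  norm_num

/-- Away from `v` the two edges of `F` at a vertex carry opposite values, and at `v` both carry `1 /
2`. So the support contains both edges or neither. -/
theorem vertexPotential_ne_zero_of_mem (h : IsOddTwoFactor ends F)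
    (hends : ∀ e, ¬ (ends e).IsDiag) {u v : V} {f : E} (hu : u ∈ h.component v) (hf : f ∈ F)
    (huf : u ∈ ends f) : h.vertexPotential v f ≠ 0 := by
  by_cases huv : u = v
  · subst huv
    rw [h.vertexPotential_eq_half hends hf huf]
    norm_num
  obtain ⟨e, he, hue⟩ := hu
  have heF := h.vertexPotential_support he
  obtain ⟨e', f', hef, hF⟩ := h.degree_two u ⟨e, heF, hue⟩
  have h0 := load_eq hef hF (fun e he => h.vertexPotential_support (v := v) he)
  rw [h.vertexLoad_vertexPotential (h.covered_of_ne_zero he), Pi.single_eq_of_ne huv] at h0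
  intro hf0
  rcases mem_pair hF heF hue with rfl | rfl <;> rcases mem_pair hF hf huf with rfl | rfl <;>
    first
    | exact he hf0
    | exact he (by linarith)

/-- Restrict the potential of `u` to the support of that of `v`. No edge of `F` leaves the component
of `v` and `u` is outside it, so the restriction has zero load and vanishes; a common vertex would
give it a nonzero value. -/
theorem disjoint_component (h : IsOddTwoFactor ends F) (hends : ∀ e, ¬ (ends e).IsDiag) {u v : V}
    (huv : u ∉ h.component v) : Disjoint (h.component u) (h.component v) := by
  rw [Set.disjoint_left]
  intro x hxu hxv
  have hu : ∃ e ∈ F, u ∈ ends e := by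
    obtain ⟨e, he, -⟩ := hxu
    exact h.covered_of_ne_zero he
  let d : E → ℝ := fun e => if h.vertexPotential v e ≠ 0 then h.vertexPotential u e else 0
  have hd : ∀ e, d e ≠ 0 → h.vertexPotential v e ≠ 0 ∧ e ∈ F := fun e he => by
    simp only [d] at he
    split_ifs at he with h1
    · exact ⟨h1, h.vertexPotential_support h1⟩
    · exact absurd rfl he
  have hload : vertexLoad ends d = 0 := by
    funext z
    by_cases hz : z ∈ h.component v
    · have : vertexLoad ends d z = vertexLoad ends (h.vertexPotential u) z := by
        rw [vertexLoad_apply, vertexLoad_apply]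
        refine sum_congr rfl fun e _ => ?_
        split_ifs with hze
        · by_cases heF : e ∈ F
          · exact if_pos (h.vertexPotential_ne_zero_of_mem hends hz heF hze)
          · have h1 : d e = 0 := by_contra fun h1 => heF (hd e h1).2
            have h2 : h.vertexPotential u e = 0 :=
              by_contra fun h1 => heF (h.vertexPotential_support h1)
            rw [h1, h2]
        · rfl
      rw [this, h.vertexLoad_vertexPotential hu,
        Pi.single_eq_of_ne (by rintro rfl; exact huv hz)]
      rfl
    · by_contra hne
      obtain ⟨e, he, hze⟩ := vertexLoad_ne_zero hne
      exact hz ⟨e, (hd e he).1, hze⟩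
  have h0 := h.eq_zero d (fun e he => (hd e he).2) hload
  obtain ⟨e, he, hxe⟩ := hxu
  have := congrFun h0 e
  simp only [d, if_pos (h.vertexPotential_ne_zero_of_mem hends hxv
    (h.vertexPotential_support he) hxe)] at this
  exact he this

theorem component_eq (h : IsOddTwoFactor ends F) (hends : ∀ e, ¬ (ends e).IsDiag) {u v : V}
    (huv : u ∈ h.component v) : h.component u = h.component v := by
  have hsub : ∀ u v, u ∈ h.component v → h.component v ⊆ h.component u := fun u v huv x hx => by
    by_contra hxu
    have hu := h.mem_component_self hends (h.covered_of_mem_component huv)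
    have hx' := h.mem_component_self hends (h.covered_of_mem_component hx)
    have hvu : v ∈ h.component u := by
      by_contra hvu
      exact Set.disjoint_left.mp (h.disjoint_component hends hvu) huv hu
    have hvx : v ∈ h.component x := by
      by_contra hvx
      exact Set.disjoint_left.mp (h.disjoint_component hends hvx) hx hx'
    exact Set.disjoint_left.mp (h.disjoint_component hends hxu) hvx hvu
  have hvu : v ∈ h.component u := by
    obtain ⟨e, he, hue⟩ := id huv
    exact hsub u v huv (h.mem_component_self hends (h.covered_of_ne_zero he))
  exact (hsub v u hvu).antisymm (hsub u v huv)

/-- Weight the loads of the potential by the signs of a two-colouring. Every edge contributes zero,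
whereas the unit load at `v` contributes `± 1`. -/
theorem isOddSet_component (h : IsOddTwoFactor ends F) (hends : ∀ e, ¬ (ends e).IsDiag) {v : V}
    (hv : ∃ e ∈ F, v ∈ ends e) : IsOddSet ends (h.component v) := by
  rintro ⟨σ, hσ⟩
  have hsum := sum_mul_vertexLoad ends (fun v => if σ v then (1 : ℝ) else -1)
    (h.vertexPotential v)
  have hzero : ∀ e, (∑ v, if v ∈ ends e then (if σ v then (1 : ℝ) else -1) else 0) *
      h.vertexPotential v e = 0 := fun e => by
    by_cases he : h.vertexPotential v e = 0
    · rw [he, mul_zero]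
    · have hdiag := hends e
      have hmem : ∀ u, u ∈ ends e → u ∈ h.component v := fun u hu => ⟨e, he, hu⟩
      have hσe := hσ e
      induction hs : ends e with
      | h a b =>
        rw [hs] at hdiag hmem
        rw [Sym2.mk_isDiag_iff] at hdiag
        rw [sum_ite_mem_sym2 _ hdiag]
        have := hσe a b hs (hmem a (Sym2.mem_mk_left a b)) (hmem b (Sym2.mem_mk_right a b))
        cases ha : σ a <;> cases hb : σ b <;> simp_all
  rw [h.vertexLoad_vertexPotential hv, sum_congr rfl (fun e _ => hzero e), sum_const_zero,
    sum_eq_single v (fun u _ hu => by rw [Pi.single_eq_of_ne hu, mul_zero])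
      (fun hv => absurd (mem_univ v) hv), Pi.single_eq_same] at hsum
  split_ifs at hsum <;> norm_num at hsum

end IsOddTwoFactor

end OddComponents

/-! ### Exchange arguments at a lexicographic optimum -/

section EdgePacking

open scoped Classical
open Finset

variable {V E : Type*} [Fintype V] [Fintype E]

/-- The sum of the edge values, each divided by the weight of the edge. -/
noncomputable def weightedSize (w : E → ℕ) : (E → ℝ) →ₗ[ℝ] ℝ :=
  ∑ e, ((w e : ℝ)⁻¹) • LinearMap.proj e

theorem weightedSize_apply (w : E → ℕ) (y : E → ℝ) :
    weightedSize w y = ∑ e, (w e : ℝ)⁻¹ * y e := by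
  simp [weightedSize]

/-- The sum of the values of the edges of weight greater than one. -/
noncomputable def heavySize (w : E → ℕ) : (E → ℝ) →ₗ[ℝ] ℝ :=
  ∑ e, (if 1 < w e then (1 : ℝ) else 0) • LinearMap.proj e

theorem heavySize_apply (w : E → ℕ) (y : E → ℝ) :
    heavySize w y = ∑ e, (if 1 < w e then (1 : ℝ) else 0) * y e := by
  simp only [heavySize, LinearMap.sum_apply, LinearMap.smul_apply, LinearMap.proj_apply,
    smul_eq_mul]

theorem weightedSize_single (w : E → ℕ) (e : E) :
    weightedSize w (Pi.single e 1) = (w e : ℝ)⁻¹ := by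
  rw [weightedSize_apply, sum_eq_single e (fun f _ hf => by simp [hf]) (by simp)]
  simp

theorem heavySize_single (w : E → ℕ) (e : E) :
    heavySize w (Pi.single e 1) = if 1 < w e then 1 else 0 := by
  rw [heavySize_apply, sum_eq_single e (fun f _ hf => by simp [hf]) (by simp)]
  simp

theorem weightedSize_of_light {w : E → ℕ} {d : E → ℝ} (h : ∀ e, d e ≠ 0 → w e = 1) :
    weightedSize w d = ∑ e, d e := by
  rw [weightedSize_apply]
  refine sum_congr rfl fun e _ => ?_
  by_cases he : d e = 0
  · simp [he]
  · simp [h e he]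

theorem heavySize_of_light {w : E → ℕ} {d : E → ℝ} (h : ∀ e, d e ≠ 0 → w e = 1) :
    heavySize w d = 0 := by
  rw [heavySize_apply]
  refine sum_eq_zero fun e _ => ?_
  by_cases he : d e = 0
  · simp [he]
  · simp [h e he]

theorem inv_le_half_of_one_lt {n : ℕ} (h : 1 < n) : (n : ℝ)⁻¹ ≤ 1 / 2 := by
  rw [one_div]
  exact inv_anti₀ two_pos (by exact_mod_cast h)

/-- Apply the dimension count with `Z` the vertices of nonintegral load. Minimality rules out
perturbations that change only nonintegral values and loads, and a vertex of integral load cannot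
lie on exactly one nonintegral edge. -/
theorem exists_isOddTwoFactor {ends : E → Sym2 V} (hends : ∀ e, ¬ (ends e).IsDiag) {a : V → ℕ}
    {obj pen : (E → ℝ) →ₗ[ℝ] ℝ} {y : E → ℝ} (hy : IsLexOptimal ends a obj pen y)
    (hmin : ∀ z, IsLexOptimal ends a obj pen z → fractCount ends y ≤ fractCount ends z) :
    ∃ F : Finset E, IsOddTwoFactor ends F ∧ (∀ e, e ∉ F → Int.fract (y e) = 0) ∧
      ∀ e ∈ F, Int.fract (y e) = 1 / 2 := by
  set F : Finset E := univ.filter fun e => Int.fract (y e) ≠ 0 with hF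
  have hmem : ∀ e, e ∈ F ↔ Int.fract (y e) ≠ 0 := fun e => by simp [hF]
  obtain ⟨h2, hZ⟩ := isOddTwoFactor_of_ker hends F
    {v | Int.fract (vertexLoad ends y v) ≠ 0} (fun v hv ⟨e, he, hve⟩ => by
      by_contra hlt
      have hsing : F.filter (fun e => v ∈ ends e) = {e} := by
        have hc : (F.filter fun e => v ∈ ends e).card = 1 := by
          have : e ∈ F.filter fun e => v ∈ ends e := mem_filter.mpr ⟨he, hve⟩
          have := card_pos.mpr ⟨e, this⟩
          omega
        obtain ⟨x, hx⟩ := card_eq_one.mp hc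
        have : e ∈ F.filter fun e => v ∈ ends e := mem_filter.mpr ⟨he, hve⟩
        rw [hx, mem_singleton] at this
        rw [hx, this]
      have hv : Int.fract (vertexLoad ends y v) = 0 := by simpa using hv
      refine (hmem e).mp he ?_
      rw [vertexLoad_eq_sum_filter, ← add_sum_erase _ y (a := e)
        (mem_filter.mpr ⟨mem_univ _, hve⟩)] at hv
      have hint : ∑ f ∈ (univ.filter fun e => v ∈ ends e).erase e, y f =
          ((∑ f ∈ (univ.filter fun e => v ∈ ends e).erase e, ⌊y f⌋ : ℤ) : ℝ) := by
        push_cast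
        refine sum_congr rfl fun f hf => ?_
        rw [mem_erase, mem_filter] at hf
        have hfF : f ∉ F := fun hfF => hf.1 (by
          have : f ∈ F.filter fun e => v ∈ ends e := mem_filter.mpr ⟨hfF, hf.2.2⟩
          simpa [hsing] using this)
        rw [hmem, not_not] at hfF
        have := Int.floor_add_fract (y f)
        rw [hfF, add_zero] at this
        exact this.symm
      rwa [hint, Int.fract_add_intCast] at hv)
    (fun d hd1 hd2 => hy.eq_zero_of_minimal hmin (fun e he => (hmem e).mp (hd1 e he)) hd2)
  refine ⟨F, h2, fun e he => by rwa [hmem, not_not] at he, fun e he => ?_⟩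
  exact h2.fract_eq_half hmem (fun v hv => by simpa using hZ v hv) he

/-- The conditions on the weights of the edges that make the fractional packings round: two edges
of weight greater than one, an odd set of vertices and such an edge, or two odd sets are joined by
an edge of weight one. -/
structure HasLightConnections (ends : E → Sym2 V) (w : E → ℕ) : Prop where
  heavy_heavy : ∀ e f, 1 < w e → 1 < w f → e ≠ f →
    ∃ x ∈ ends e, ∃ x' ∈ ends f, ∃ g, w g = 1 ∧ ends g = s(x, x')
  odd_heavy : ∀ U, IsOddSet ends U → ∀ e, 1 < w e → (∀ x ∈ ends e, x ∉ U) →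
    ∃ u ∈ U, ∃ x ∈ ends e, ∃ g, w g = 1 ∧ ends g = s(u, x)
  odd_odd : ∀ U U', IsOddSet ends U → IsOddSet ends U' → Disjoint U U' →
    ∃ u ∈ U, ∃ u' ∈ U', ∃ g, w g = 1 ∧ ends g = s(u, u')

variable {ends : E → Sym2 V} {w : E → ℕ} {a : V → ℕ} {y : E → ℝ} {F : Finset E}

omit [Fintype V] in
-- Move value from `e` and `f` to the light edge that joins them. The size changes by `1 - 1 / w e -
-- 1 / w f ≥ 0`, while the heavy value drops.
theorem HasLightConnections.heavy_unique (hc : HasLightConnections ends w)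
    (hends : ∀ e, ¬ (ends e).IsDiag)
    (hy : IsLexOptimal ends a (weightedSize w) (heavySize w) y) {e f : E} (he : 1 < w e)
    (hf : 1 < w f) (hye : 0 < y e) (hyf : 0 < y f) : e = f := by
  by_contra hef
  obtain ⟨x, hx, x', hx', g, hg, hgs⟩ := hc.heavy_heavy e f he hf hef
  have hxx : x ≠ x' := fun h => hends g (by rw [hgs, h]; exact Sym2.mk_isDiag_iff.mpr rfl)
  have := hy.not_improving (d := Pi.single g 1 - Pi.single e 1 - Pi.single f 1)
    (fun i hi => by
      by_cases h1 : i = e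
      · exact h1 ▸ hye
      by_cases h2 : i = f
      · exact h2 ▸ hyf
      simp only [Pi.sub_apply, Pi.single_eq_of_ne h1, Pi.single_eq_of_ne h2, sub_zero] at hi
      rw [Pi.single_apply] at hi
      split_ifs at hi <;> norm_num at hi)
    (fun v => by
      simp only [map_sub, Pi.sub_apply, vertexLoad_single, hgs, Sym2.mem_iff]
      by_cases h1 : v = x
      · have h2 : v ≠ x' := h1 ▸ hxx
        rw [if_pos (Or.inl h1), if_pos (h1 ▸ hx)]
        split_ifs <;> norm_num
      · by_cases h2 : v = x'
        · rw [if_pos (Or.inr h2), if_pos (c := v ∈ ends f) (h2 ▸ hx')]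
          split_ifs <;> norm_num
        · rw [if_neg (by tauto)]
          split_ifs <;> norm_num)
    (by
      simp only [map_sub, weightedSize_single, hg]
      have h1 := inv_le_half_of_one_lt he
      have h2 := inv_le_half_of_one_lt hf
      norm_num
      linarith)
  simp only [map_sub, heavySize_single, hg, if_pos he, if_pos hf] at this
  norm_num at this

/-- If `g` is not in `F`, all of `F` is light. Lowering `g` frees load at `x`, which the potential
of `x` uses up: the size changes by `1 / 2 - 1 / w g ≥ 0`, and the heavy value drops. -/
theorem IsLexOptimal.heavy_mem_of_covered (hends : ∀ e, ¬ (ends e).IsDiag)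
    (hy : IsLexOptimal ends a (weightedSize w) (heavySize w) y) (hF : IsOddTwoFactor ends F)
    (hpos : ∀ e ∈ F, 0 < y e) {g : E} (hg : 1 < w g) (hyg : 0 < y g)
    (hlight : ∀ e, e ≠ g → 0 < y e → w e = 1) {x : V} (hx : x ∈ ends g)
    (hcov : ∃ e ∈ F, x ∈ ends e) : g ∈ F := by
  by_contra hgF
  have hsupp : ∀ e, hF.vertexPotential x e ≠ 0 → w e = 1 := fun e he => by
    have heF := hF.vertexPotential_support he
    exact hlight e (fun h => hgF (h ▸ heF)) (hpos e heF)
  have := hy.not_improving (d := hF.vertexPotential x - Pi.single g 1)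
    (fun i hi => by
      by_cases h1 : i = g
      · exact h1 ▸ hyg
      simp only [Pi.sub_apply, Pi.single_eq_of_ne h1, sub_zero] at hi
      exact hpos i (hF.vertexPotential_support hi.ne))
    (fun v => by
      simp only [map_sub, Pi.sub_apply, vertexLoad_single, hF.vertexLoad_vertexPotential hcov]
      by_cases h1 : v = x
      · subst h1
        rw [if_pos hx, Pi.single_eq_same, sub_self]
      · rw [Pi.single_eq_of_ne h1]
        split_ifs <;> norm_num)
    (by
      rw [map_sub, weightedSize_single, weightedSize_of_light hsupp,
        hF.sum_vertexPotential hends hcov]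
      linarith [inv_le_half_of_one_lt hg])
  rw [map_sub, heavySize_single, heavySize_of_light hsupp, if_pos hg] at this
  norm_num at this

/-- Otherwise a light edge joins a vertex `u` of the cycle to an end of `g`. Raise it while lowering
`g` and the potential of `u`: the size changes by `1 - 1 / 2 - 1 / w g ≥ 0`, and the heavy value
drops. -/
theorem HasLightConnections.heavy_meets_component (hc : HasLightConnections ends w)
    (hends : ∀ e, ¬ (ends e).IsDiag)
    (hy : IsLexOptimal ends a (weightedSize w) (heavySize w) y) (hF : IsOddTwoFactor ends F)
    (hpos : ∀ e ∈ F, 0 < y e) {g : E} (hg : 1 < w g) (hyg : 0 < y g)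
    (hlight : ∀ e, e ≠ g → 0 < y e → w e = 1) {v : V} (hv : ∃ e ∈ F, v ∈ ends e) :
    ∃ x ∈ ends g, x ∈ hF.component v := by
  by_contra! hdisj
  obtain ⟨u, hu, x, hx, f, hf, hfs⟩ :=
    hc.odd_heavy _ (hF.isOddSet_component hends hv) g hg hdisj
  have hux : u ≠ x := fun h => hends f (by rw [hfs, h]; exact Sym2.mk_isDiag_iff.mpr rfl)
  have hcov := hF.covered_of_mem_component hu
  have hsupp : ∀ e, hF.vertexPotential u e ≠ 0 → w e = 1 := fun e he => by
    refine hlight e (fun h => ?_) (hpos e (hF.vertexPotential_support he))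
    subst h
    refine hdisj x hx ?_
    rw [← hF.component_eq hends hu]
    exact ⟨e, he, hx⟩
  have := hy.not_improving (d := Pi.single f 1 - hF.vertexPotential u - Pi.single g 1)
    (fun i hi => by
      by_cases h1 : i = g
      · exact h1 ▸ hyg
      simp only [Pi.sub_apply, Pi.single_eq_of_ne h1, sub_zero] at hi
      refine hpos i (hF.vertexPotential_support (v := u) fun h0 => ?_)
      rw [h0, sub_zero, Pi.single_apply] at hi
      split_ifs at hi <;> norm_num at hi)
    (fun v => by
      simp only [map_sub, Pi.sub_apply, vertexLoad_single, hF.vertexLoad_vertexPotential hcov,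
        hfs, Sym2.mem_iff]
      by_cases h1 : v = u
      · subst h1
        rw [if_pos (Or.inl rfl), Pi.single_eq_same]
        split_ifs <;> norm_num
      · rw [Pi.single_eq_of_ne h1]
        by_cases h2 : v = x
        · rw [if_pos (Or.inr h2), if_pos (h2 ▸ hx)]
          norm_num
        · rw [if_neg (by tauto)]
          split_ifs <;> norm_num)
    (by
      rw [map_sub, map_sub, weightedSize_single, weightedSize_single, weightedSize_of_light hsupp,
        hF.sum_vertexPotential hends hcov, hf]
      have := inv_le_half_of_one_lt hg
      norm_num
      linarith)
  rw [map_sub, map_sub, heavySize_single, heavySize_single, heavySize_of_light hsupp, if_pos hg,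
    hf] at this
  norm_num at this

/-- Two cycles are joined by a light edge `u' v'`. Adding it and subtracting both potentials leaves
all loads, the size and the heavy value unchanged, but makes values on the cycles integral, contrary
to the minimal count. -/
theorem HasLightConnections.component_unique (hc : HasLightConnections ends w)
    (hends : ∀ e, ¬ (ends e).IsDiag)
    (hy : IsLexOptimal ends a (weightedSize w) (heavySize w) y)
    (hmin : ∀ z, IsLexOptimal ends a (weightedSize w) (heavySize w) z →
      fractCount ends y ≤ fractCount ends z)
    (hF : IsOddTwoFactor ends F) (hint : ∀ e, e ∉ F → Int.fract (y e) = 0)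
    (hhalf : ∀ e ∈ F, Int.fract (y e) = 1 / 2) (hlight : ∀ e ∈ F, w e = 1) {u v : V}
    (hu : ∃ e ∈ F, u ∈ ends e) (hv : ∃ e ∈ F, v ∈ ends e) : u ∈ hF.component v := by
  by_contra huv
  obtain ⟨u', hu', v', hv', g, hg, hgs⟩ := hc.odd_odd _ _ (hF.isOddSet_component hends hu)
    (hF.isOddSet_component hends hv) (hF.disjoint_component hends huv)
  have hdisj : Disjoint (hF.component u') (hF.component v') := by
    rw [hF.component_eq hends hu', hF.component_eq hends hv']
    exact hF.disjoint_component hends huv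
  have hcu := hF.covered_of_mem_component hu'
  have hcv := hF.covered_of_mem_component hv'
  have hgF : g ∉ F := fun hgF => by
    have h1 := hF.vertexPotential_ne_zero_of_mem hends (hF.mem_component_self hends hcu) hgF
      (by rw [hgs]; exact Sym2.mem_mk_left _ _)
    have h2 : v' ∈ hF.component u' := ⟨g, h1, by rw [hgs]; exact Sym2.mem_mk_right _ _⟩
    exact Set.disjoint_left.mp hdisj h2 (hF.mem_component_self hends hcv)
  have hnot : ∀ e, hF.vertexPotential u' e ≠ 0 → hF.vertexPotential v' e = 0 := fun e he => by
    by_contra he'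
    obtain ⟨x, hx⟩ : ∃ x, x ∈ ends e := by
      induction ends e with
      | h a b => exact ⟨a, Sym2.mem_mk_left a b⟩
    exact Set.disjoint_left.mp hdisj ⟨e, he, hx⟩ ⟨e, he', hx⟩
  have hsupp : ∀ x e, hF.vertexPotential x e ≠ 0 → w e = 1 := fun x e he =>
    hlight e (hF.vertexPotential_support he)
  set d : E → ℝ := Pi.single g 1 - hF.vertexPotential u' - hF.vertexPotential v' with hd
  have hload : vertexLoad ends d = 0 := by
    have huv' : u' ≠ v' := fun h => hends g (by rw [hgs, h]; exact Sym2.mk_isDiag_iff.mpr rfl)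
    funext x
    simp only [hd, map_sub, Pi.sub_apply, vertexLoad_single, hF.vertexLoad_vertexPotential hcu,
      hF.vertexLoad_vertexPotential hcv, hgs, Sym2.mem_iff, Pi.zero_apply, Pi.single_apply]
    by_cases h1 : x = u'
    · subst h1; simp [huv']
    · by_cases h2 : x = v' <;> simp [h1, h2, huv'.symm]
  have hle : ∀ x e, |hF.vertexPotential x e| ≤ 1 / 2 := fun x e => by
    by_cases h0 : hF.vertexPotential x e = 0
    · rw [h0]; norm_num
    · exact (hF.abs_vertexPotential hends h0).le
  have hval : ∀ e, e ∉ F → hF.vertexPotential u' e = 0 ∧ hF.vertexPotential v' e = 0 :=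
    fun e he => ⟨by_contra fun h => he (hF.vertexPotential_support h),
      by_contra fun h => he (hF.vertexPotential_support h)⟩
  have hfeas : IsFeasible ends a (y + d) := by
    refine ⟨fun e => ?_, fun v => ?_⟩
    · have h0 := hy.feasible.1 e
      simp only [Pi.zero_apply] at h0
      simp only [hd, Pi.add_apply, Pi.sub_apply, Pi.zero_apply]
      have hs : (0 : ℝ) ≤ (Pi.single g 1 : E → ℝ) e := by
        rw [Pi.single_apply]; split_ifs <;> norm_num
      by_cases heF : e ∈ F
      · have h1 := hhalf e heF
        have h2 := Int.floor_add_fract (y e)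
        have h3 : (0 : ℝ) ≤ ⌊y e⌋ := by exact_mod_cast Int.floor_nonneg.mpr h0
        by_cases h4 : hF.vertexPotential u' e = 0
        · have := (abs_le.mp (hle v' e)).2
          linarith
        · have h5 := hnot e h4
          have := (abs_le.mp (hle u' e)).2
          linarith
      · rw [(hval e heF).1, (hval e heF).2]
        linarith
    · rw [map_add, hload, add_zero]
      exact hy.feasible.2 v
  have hlex := hy.of_eq hfeas
    (by
      rw [map_add, hd, map_sub, map_sub, weightedSize_single, weightedSize_of_light (hsupp u'),
        weightedSize_of_light (hsupp v'), hF.sum_vertexPotential hends hcu,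
        hF.sum_vertexPotential hends hcv, hg]
      norm_num)
    (by
      rw [map_add, hd, map_sub, map_sub, heavySize_single, heavySize_of_light (hsupp u'),
        heavySize_of_light (hsupp v'), hg]
      norm_num)
  refine (hmin _ hlex).not_gt (card_lt_card ⟨fun i => ?_, fun hsub => ?_⟩)
  · simp only [mem_filter, mem_univ, true_and]
    rcases i with e | x
    · simp only [Sum.elim_inl, Pi.add_apply]
      intro he
      by_cases heF : e ∈ F
      · rw [hhalf e heF]; norm_num
      · exfalso
        refine he ?_
        simp only [hd, Pi.sub_apply, (hval e heF).1, (hval e heF).2, sub_zero, Pi.single_apply]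
        split_ifs
        · rw [Int.fract_add_one]; exact hint e heF
        · rw [add_zero]; exact hint e heF
    · simp [hload]
  · obtain ⟨e, he, hue⟩ := hcu
    have h1 := hF.vertexPotential_eq_half hends he hue
    have h2 := hnot e (by rw [h1]; norm_num)
    have h3 : Sum.inl e ∈ univ.filter fun i : E ⊕ V =>
        Int.fract (Sum.elim y (vertexLoad ends y) i) ≠ 0 := by
      simp only [mem_filter, mem_univ, true_and, Sum.elim_inl, hhalf e he]
      norm_num
    have h4 := hsub h3
    simp only [mem_filter, mem_univ, true_and, Sum.elim_inl, Pi.add_apply] at h4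
    refine h4 ?_
    have heg : e ≠ g := fun h => hgF (h ▸ he)
    simp only [hd, Pi.sub_apply, h1, h2, Pi.single_eq_of_ne heg]
    have h5 := Int.floor_add_fract (y e)
    rw [hhalf e he] at h5
    have h6 : y e + (0 - 1 / 2 - 0) = (⌊y e⌋ : ℝ) := by linarith
    rw [h6, Int.fract_intCast]

end EdgePacking

/-! ### Rounding the optimum -/

section IntegralPacking

open scoped Classical
open Finset

variable {V E : Type*} [Fintype V] [Fintype E] {ends : E → Sym2 V} {w : E → ℕ} {a : V → ℕ}

omit [Fintype V] in
/-- Rounding down an integral packing in which at most one edge has weight greater than one. -/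
theorem IsFeasible.exists_packing {z : E → ℝ} (hz : IsFeasible ends a z)
    (hint : ∀ e, Int.fract (z e) = 0) (hw : ∀ e, 1 ≤ w e) (g : E)
    (hlight : ∀ e, e ≠ g → z e ≠ 0 → w e = 1) {t : ℕ}
    (ht : (t : ℝ) < weightedSize w z + (w g : ℝ)⁻¹) :
    ∃ c : E → ℕ, t ≤ ∑ e, c e ∧ ∀ v, ∑ e, (if v ∈ ends e then w e * c e else 0) ≤ a v := by
  have hn : ∀ e, ∃ n : ℕ, z e = n := fun e => by
    have h1 := Int.floor_add_fract (z e)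
    rw [hint, add_zero] at h1
    have h2 := Int.toNat_of_nonneg (Int.floor_nonneg.mpr (hz.1 e))
    exact ⟨⌊z e⌋.toNat, h1.symm.trans (by exact_mod_cast h2.symm)⟩
  choose n hn using hn
  refine ⟨fun e => n e / w e, ?_, fun v => ?_⟩
  · have hkey : ∀ e, (w e : ℝ)⁻¹ * z e - (if e = g then 1 - (w g : ℝ)⁻¹ else 0) ≤
        ((n e / w e : ℕ) : ℝ) := fun e => by
      rw [hn]
      by_cases heg : e = g
      · subst heg
        rw [if_pos rfl]
        have hpos : (0 : ℝ) < w e := by exact_mod_cast hw e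
        have h1 : n e + 1 ≤ w e * (n e / w e) + w e := by
          have := Nat.div_add_mod (n e) (w e)
          have := Nat.mod_lt (n e) (hw e)
          omega
        have h2 : (n e : ℝ) + 1 ≤ w e * ((n e / w e : ℕ) : ℝ) + w e := by exact_mod_cast h1
        have h3 : (w e : ℝ)⁻¹ * n e - (1 - (w e : ℝ)⁻¹) = (w e : ℝ)⁻¹ * (n e + 1 - w e) := by
          field_simp
          ring
        rw [h3, inv_mul_le_iff₀ hpos]
        linarith
      · rw [if_neg heg, sub_zero]
        by_cases h0 : n e = 0
        · simp [h0]
        · rw [hlight e heg (by rw [hn]; exact_mod_cast h0)]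
          simp
    have hsum := sum_le_sum fun e (_ : e ∈ univ) => hkey e
    rw [sum_sub_distrib, ← weightedSize_apply, sum_ite_eq' univ g, if_pos (mem_univ g)] at hsum
    have : (t : ℝ) < ((∑ e, n e / w e : ℕ) : ℝ) + 1 := by
      push_cast
      linarith
    exact Nat.lt_succ_iff.mp (by exact_mod_cast this)
  · have h1 := hz.2 v
    rw [vertexLoad_apply] at h1
    have h2 : (∑ e, if v ∈ ends e then n e else 0) ≤ a v := by
      have : ((∑ e, if v ∈ ends e then n e else 0 : ℕ) : ℝ) ≤ a v := by
        push_cast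
        simpa only [hn] using h1
      exact_mod_cast this
    refine (sum_le_sum fun e _ => ?_).trans h2
    split_ifs
    · exact Nat.mul_div_le _ _
    · exact le_rfl

/-- A fractional packing of weighted edges can be rounded to an integral one of the same size. -/
theorem HasLightConnections.exists_packing (hc : HasLightConnections ends w)
    (hends : ∀ e, ¬ (ends e).IsDiag) (hw : ∀ e, 1 ≤ w e) {y₀ : E → ℝ}
    (hy₀ : IsFeasible ends a y₀) {t : ℕ} (ht : (t : ℝ) ≤ weightedSize w y₀) :
    ∃ c : E → ℕ, t ≤ ∑ e, c e ∧ ∀ v, ∑ e, (if v ∈ ends e then w e * c e else 0) ≤ a v := by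
  obtain ⟨y, hy, hmin⟩ := exists_isLexOptimal_minimal ends a (weightedSize w) (heavySize w)
  replace ht : (t : ℝ) ≤ weightedSize w y := ht.trans (hy.obj_le _ hy₀)
  obtain ⟨F, hF, hint, hhalf⟩ := exists_isOddTwoFactor hends hy hmin
  have hpos : ∀ e ∈ F, 0 < y e := fun e he => by
    refine lt_of_le_of_ne (hy.feasible.1 e) fun h => ?_
    have := hhalf e he
    rw [← h] at this
    norm_num at this
  have hinvpos : ∀ e, (0 : ℝ) < (w e : ℝ)⁻¹ := fun e =>
    inv_pos.mpr (by exact_mod_cast hw e)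
  have hheavy : ∀ g, 1 < w g → 0 < y g → ∀ e, e ≠ g → 0 < y e → w e = 1 :=
    fun g hg hyg e heg hye => by
      by_contra hne
      exact heg (hc.heavy_unique hends hy (lt_of_le_of_ne (hw e) (Ne.symm hne)) hg hye hyg)
  have hypos : ∀ e, y e ≠ 0 → 0 < y e := fun e he => lt_of_le_of_ne (hy.feasible.1 e) he.symm
  rcases F.eq_empty_or_nonempty with hE | ⟨e₀, he₀⟩
  · have hint' : ∀ e, Int.fract (y e) = 0 := fun e => hint e (by simp [hE])
    by_cases hg : ∃ g, 1 < w g ∧ 0 < y g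
    · obtain ⟨g, hg, hyg⟩ := hg
      exact hy.feasible.exists_packing hint' hw g
        (fun e he h0 => hheavy g hg hyg e he (hypos e h0)) (by linarith [hinvpos g])
    · rcases isEmpty_or_nonempty E with hem | ⟨⟨g⟩⟩
      · refine ⟨fun _ => 0, ?_, fun v => by simp⟩
        rw [weightedSize_apply, univ_eq_empty, sum_empty] at ht
        have : t = 0 := by exact_mod_cast le_antisymm ht (Nat.cast_nonneg t)
        simp [this]
      · push Not at hg
        refine hy.feasible.exists_packing hint' hw g (fun e _ h0 => ?_) (by linarith [hinvpos g])
        by_contra hne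
        exact (hypos e h0).not_ge (hg e (lt_of_le_of_ne (hw e) (Ne.symm hne)))
  -- Take for `g` the heavy edge of the support if there is one, and any edge of `F` otherwise. The
  -- last condition says that `F` is a single cycle.
  obtain ⟨g, hgF, hlight, hcomp⟩ : ∃ g ∈ F, (∀ e, e ≠ g → 0 < y e → w e = 1) ∧
      ∀ x ∈ ends g, ∀ v, (∃ e ∈ F, v ∈ ends e) → v ∈ hF.component x := by
    have hex : ∀ e, ∃ x, x ∈ ends e := fun e => by
      induction ends e with
      | h a b => exact ⟨a, Sym2.mem_mk_left a b⟩
    by_cases hg : ∃ g, 1 < w g ∧ 0 < y g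
    · obtain ⟨g, hg, hyg⟩ := hg
      have hl := hheavy g hg hyg
      have hgF : g ∈ F := by
        obtain ⟨x₀, hx₀⟩ := hex e₀
        obtain ⟨x, hx, hxc⟩ := hc.heavy_meets_component hends hy hF hpos hg hyg hl ⟨e₀, he₀, hx₀⟩
        exact hy.heavy_mem_of_covered hends hF hpos hg hyg hl hx (hF.covered_of_mem_component hxc)
      refine ⟨g, hgF, hl, fun x hx v hv => ?_⟩
      obtain ⟨x', hx', hxc⟩ := hc.heavy_meets_component hends hy hF hpos hg hyg hl hv
      have h1 : x' ∈ hF.component x :=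
        ⟨g, by rw [hF.vertexPotential_eq_half hends hgF hx]; norm_num, hx'⟩
      rw [← hF.component_eq hends h1, hF.component_eq hends hxc]
      exact hF.mem_component_self hends hv
    · push Not at hg
      have hl : ∀ e, 0 < y e → w e = 1 := fun e he => by
        by_contra hne
        exact he.not_ge (hg e (lt_of_le_of_ne (hw e) (Ne.symm hne)))
      exact ⟨e₀, he₀, fun e _ he => hl e he, fun x hx v hv =>
        hc.component_unique hends hy hmin hF hint hhalf (fun e he => hl e (hpos e he)) hv
          ⟨e₀, he₀, hx⟩⟩
  obtain ⟨x, hx⟩ : ∃ x, x ∈ ends g := by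
    induction ends g with
    | h a b => exact ⟨a, Sym2.mem_mk_left a b⟩
  have hcov : ∃ e ∈ F, x ∈ ends e := ⟨g, hgF, hx⟩
  have hsupp : ∀ e, e ∉ F → hF.vertexPotential x e = 0 := fun e he =>
    by_contra fun h => he (hF.vertexPotential_support h)
  have habs : ∀ e ∈ F, |hF.vertexPotential x e| = 1 / 2 := fun e he => by
    obtain ⟨u, hu⟩ : ∃ u, u ∈ ends e := by
      induction ends e with
      | h a b => exact ⟨a, Sym2.mem_mk_left a b⟩
    exact hF.abs_vertexPotential hends
      (hF.vertexPotential_ne_zero_of_mem hends (hcomp x hx u ⟨e, he, hu⟩) he hu)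
  have hfl : ∀ e ∈ F, y e = ⌊y e⌋ + 1 / 2 := fun e he => by
    have := Int.floor_add_fract (y e)
    rw [hhalf e he] at this
    exact this.symm
  -- On `F` the values of `y` are at least `1 / 2` and the potential is `± 1 / 2`, so subtraction
  -- gives nonnegative values, integral on `F`, and lowers only the load at `x`.
  have hfeas : IsFeasible ends a (y - hF.vertexPotential x) := by
    refine ⟨fun e => ?_, fun v => ?_⟩
    · simp only [Pi.zero_apply, Pi.sub_apply]
      by_cases he : e ∈ F
      · have h1 := hfl e he
        have h2 : (0 : ℝ) ≤ ⌊y e⌋ := by exact_mod_cast Int.floor_nonneg.mpr (hpos e he).le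
        have h3 := (abs_le.mp (habs e he).le).2
        linarith
      · rw [hsupp e he, sub_zero]
        exact hy.feasible.1 e
    · rw [map_sub, hF.vertexLoad_vertexPotential hcov, Pi.sub_apply, Pi.single_apply]
      have := hy.feasible.2 v
      split_ifs <;> linarith
  refine hfeas.exists_packing (fun e => ?_) hw g (fun e he h0 => ?_) ?_
  · rw [Pi.sub_apply]
    by_cases he : e ∈ F
    · rcases abs_eq (by norm_num) |>.mp (habs e he) with h1 | h1
      · rw [h1, hfl e he, add_sub_cancel_right, Int.fract_intCast]
      · have h2 : y e - hF.vertexPotential x e = ((⌊y e⌋ + 1 : ℤ) : ℝ) := by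
          push_cast
          rw [h1]
          linarith [hfl e he]
        rw [h2, Int.fract_intCast]
    · rw [hsupp e he, sub_zero]
      exact hint e he
  · refine hlight e he ?_
    by_cases heF : e ∈ F
    · exact hpos e heF
    · rw [Pi.sub_apply, hsupp e heF, sub_zero] at h0
      exact hypos e h0
  · have h1 := hF.sum_vertexPotential hends hcov
    have hg := hF.vertexPotential_eq_half hends hgF hx
    -- The potential has total `1 / 2`, all of it accounted for by its value at `g`, so its values
    -- on the remaining, light edges cancel.
    have h2 : weightedSize w (hF.vertexPotential x) = (w g : ℝ)⁻¹ * (1 / 2) := by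
      rw [weightedSize_apply, ← add_sum_erase _ _ (mem_univ g), hg]
      rw [← add_sum_erase _ _ (mem_univ g), hg] at h1
      have h3 : ∑ e ∈ univ.erase g, (w e : ℝ)⁻¹ * hF.vertexPotential x e =
          ∑ e ∈ univ.erase g, hF.vertexPotential x e := by
        refine sum_congr rfl fun e he => ?_
        by_cases heF : e ∈ F
        · rw [hlight e (ne_of_mem_erase he) (hpos e heF)]
          simp
        · rw [hsupp e heF, mul_zero]
      rw [h3]
      linarith
    rw [map_sub, h2]
    linarith [hinvpos g]

end IntegralPacking

/-! ### Powers of monomial ideals and their integral closures -/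

section MonomialIdeal

open Finset MvPolynomial
open scoped Pointwise

variable {k V E : Type*} [Field k]

/-- The ideal generated by the monomials with the exponents `m e`. -/
noncomputable def monomialIdeal (k : Type*) [Field k] (m : E → V →₀ ℕ) :
    Ideal (MvPolynomial V k) :=
  Ideal.span (Set.range fun e => monomial (m e) (1 : k))

theorem prod_monomial_one {ι : Type*} (s : Finset ι) (f : ι → V →₀ ℕ) :
    ∏ i ∈ s, monomial (f i) (1 : k) = monomial (∑ i ∈ s, f i) 1 := by
  classical
  induction s using Finset.induction_on with
  | empty => rfl
  | insert i s hi ih => rw [prod_insert hi, sum_insert hi, ih, monomial_mul, one_mul]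

theorem monomialIdeal_pow [Fintype E] (m : E → V →₀ ℕ) (t : ℕ) :
    monomialIdeal k m ^ t = Ideal.span ((fun b => monomial b (1 : k)) ''
      {b | ∃ c : E → ℕ, ∑ e, c e = t ∧ b = ∑ e, c e • m e}) := by
  classical
  rw [monomialIdeal, Ideal.span, Submodule.span_pow]
  congr 1
  ext p
  rw [Set.mem_pow]
  constructor
  · rintro ⟨f, rfl⟩
    have hf : ∀ i, ∃ e, monomial (m e) (1 : k) = f i := fun i => (f i).2
    choose g hg using hf
    refine ⟨_, ⟨fun e => (univ.filter fun i => g i = e).card, ?_, rfl⟩, ?_⟩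
    · rw [← card_eq_sum_card_fiberwise (fun i _ => mem_coe.mpr (mem_univ (g i)))]
      simp
    · rw [List.prod_ofFn]
      simp only [← hg]
      have hsum : ∑ i, m (g i) = ∑ e, (univ.filter fun i => g i = e).card • m e := by
        rw [← sum_fiberwise univ g fun i => m (g i)]
        refine sum_congr rfl fun e _ => ?_
        rw [sum_congr rfl (g := fun _ => m e) fun i hi => by rw [(mem_filter.mp hi).2], sum_const]
      rw [prod_monomial_one, hsum]
  · rintro ⟨_, ⟨c, hc, rfl⟩, rfl⟩
    have hcard : Fintype.card (Σ e, Fin (c e)) = t := by simp [hc]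
    let φ : Fin t ≃ Σ e, Fin (c e) := (Fintype.equivFinOfCardEq hcard).symm
    refine ⟨fun i => ⟨monomial (m (φ i).1) 1, (φ i).1, rfl⟩, ?_⟩
    rw [List.prod_ofFn]
    simp only
    rw [prod_monomial_one, φ.sum_comp (fun x => m x.1), Fintype.sum_sigma]
    simp

theorem mem_monomialIdeal_pow [Fintype E] {m : E → V →₀ ℕ} {t : ℕ} {p : MvPolynomial V k} :
    p ∈ monomialIdeal k m ^ t ↔
      ∀ b ∈ p.support, ∃ c : E → ℕ, ∑ e, c e = t ∧ ∑ e, c e • m e ≤ b := by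
  rw [monomialIdeal_pow, mem_ideal_span_monomial_image]
  refine forall₂_congr fun b _ => ?_
  constructor
  · rintro ⟨_, ⟨c, hc, rfl⟩, hb⟩
    exact ⟨c, hc, hb⟩
  · rintro ⟨c, hc, hb⟩
    exact ⟨_, ⟨c, hc, rfl⟩, hb⟩

theorem mem_monomialIdeal_pow_of_le [Fintype E] {m : E → V →₀ ℕ} {t : ℕ} {p : MvPolynomial V k}
    (h : ∀ b ∈ p.support, ∃ c : E → ℕ, t ≤ ∑ e, c e ∧ ∑ e, c e • m e ≤ b) :
    p ∈ monomialIdeal k m ^ t := by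
  rw [p.as_sum]
  refine sum_mem fun b hb => ?_
  obtain ⟨c, hc, hcb⟩ := h b hb
  refine Ideal.pow_le_pow_right hc (mem_monomialIdeal_pow.mpr fun b' hb' => ?_)
  rw [mem_singleton.mp (support_monomial_subset hb')]
  exact ⟨c, rfl, hcb⟩

section WeightGrading

variable [Fintype V]

/-- The ring homomorphism that records the `z`-weight of every monomial as the exponent of a Hahn
series. -/
noncomputable def weightSeries (k : Type*) [Field k] (z : V → ℝ) :
    MvPolynomial V k →+* HahnSeries ℝ (MvPolynomial V k) :=
  eval₂Hom (HahnSeries.C.comp MvPolynomial.C) fun i => HahnSeries.single (z i) (X i)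

theorem weightSeries_monomial (z : V → ℝ) (b : V →₀ ℕ) (c : k) :
    weightSeries k z (monomial b c) = HahnSeries.single (∑ i, z i * b i) (monomial b c) := by
  classical
  rw [weightSeries, coe_eval₂Hom, eval₂_monomial, Finsupp.prod_fintype _ _ (fun i => pow_zero _)]
  have hprod : ∀ s : Finset V, ∏ i ∈ s, (HahnSeries.single (z i) (X i : MvPolynomial V k)) ^ b i =
      HahnSeries.single (∑ i ∈ s, z i * b i) (∏ i ∈ s, X i ^ b i) := fun s => by
    induction s using Finset.induction_on with
    | empty => rfl
    | insert i s hi ih =>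
      rw [prod_insert hi, sum_insert hi, prod_insert hi, ih, HahnSeries.single_pow,
        HahnSeries.single_mul_single, nsmul_eq_mul, mul_comm (b i : ℝ)]
  rw [hprod, RingHom.comp_apply, HahnSeries.C_apply, HahnSeries.single_mul_single, zero_add,
    monomial_eq, Finsupp.prod_fintype _ _ (fun i => pow_zero _)]

theorem coeff_weightSeries (z : V → ℝ) (p : MvPolynomial V k) (g : ℝ) :
    (weightSeries k z p).coeff g =
      ∑ b ∈ p.support, if g = ∑ i, z i * b i then monomial b (p.coeff b) else 0 := by
  classical
  conv_lhs => rw [p.as_sum, map_sum]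
  rw [HahnSeries.coeff_sum]
  refine sum_congr rfl fun b _ => ?_
  rw [weightSeries_monomial, HahnSeries.coeff_single]

/-- The coefficients of the series are themselves polynomials, so distinct monomials of equal weight
do not cancel. -/
theorem coeff_weightSeries_ne_zero (z : V → ℝ) {p : MvPolynomial V k} {b : V →₀ ℕ}
    (hb : b ∈ p.support) : (weightSeries k z p).coeff (∑ i, z i * b i) ≠ 0 := by
  classical
  intro h
  have := congrArg (MvPolynomial.coeff b) h
  rw [coeff_weightSeries, coeff_sum, sum_eq_single b] at this
  · rw [if_pos rfl, coeff_monomial, if_pos rfl, MvPolynomial.coeff_zero] at this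
    exact mem_support_iff.mp hb this
  · intro b' _ hne
    split_ifs
    · rw [coeff_monomial, if_neg hne]
    · rfl
  · exact fun h => absurd hb h

theorem le_orderTop_weightSeries (z : V → ℝ) {p : MvPolynomial V k} {s : ℝ}
    (h : ∀ b ∈ p.support, s ≤ ∑ i, z i * b i) : (s : WithTop ℝ) ≤ (weightSeries k z p).orderTop := by
  rw [HahnSeries.le_orderTop_iff_forall]
  intro g hg
  rw [coeff_weightSeries]
  refine sum_eq_zero fun b hb => if_neg fun hgb => ?_
  have := h b hb
  rw [← hgb] at this
  exact (WithTop.coe_lt_coe.mp hg).not_ge this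

/-- A linear function that is large on the exponents of the powers of an ideal is large on the
exponents of the elements that are integral over it. -/
theorem IsIntegralOverIdeal.le_weight {J : Ideal (MvPolynomial V k)} {r : MvPolynomial V k}
    (hr : IsIntegralOverIdeal J r) (z : V → ℝ) (u : ℝ)
    (hJ : ∀ i : ℕ, 1 ≤ i → ∀ p ∈ J ^ i, ∀ b ∈ p.support, i * u ≤ ∑ j, z j * (b j : ℝ))
    {b : V →₀ ℕ} (hb : b ∈ r.support) : u ≤ ∑ j, z j * b j := by
  obtain ⟨n, hn, a, ha, heq⟩ := hr
  have hne := coeff_weightSeries_ne_zero z hb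
  set R := weightSeries k z r with hR
  have hR0 : R ≠ 0 := fun h => hne (by rw [h]; rfl)
  refine le_trans ?_ (HahnSeries.order_le_of_coeff_ne_zero hne)
  -- If the order of `R` were below `u`, every term `a i * R ^ (n - i)` would have order at least `i
  -- * u + (n - i) * R.order > n * R.order`, so none could cancel the leading coefficient of `R ^
  -- n`.
  by_contra! hlt
  have hpow : R ^ n = -∑ i ∈ Icc 1 n, weightSeries k z (a i) * R ^ (n - i) := by
    have := congrArg (weightSeries k z) heq
    rw [map_add, map_pow, map_sum, map_zero] at this
    simp only [map_mul, map_pow] at this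
    exact eq_neg_of_add_eq_zero_left this
  have hcoeff : (R ^ n).coeff (n • R.order) ≠ 0 := by
    rw [← HahnSeries.order_pow]
    exact fun h => pow_ne_zero n hR0 (HahnSeries.coeff_order_eq_zero.mp h)
  refine hcoeff ?_
  rw [hpow, HahnSeries.coeff_neg, HahnSeries.coeff_sum, neg_eq_zero]
  refine sum_eq_zero fun i hi => HahnSeries.coeff_eq_zero_of_lt_orderTop ?_
  obtain ⟨hi1, hin⟩ := mem_Icc.mp hi
  rw [HahnSeries.orderTop_mul]
  have h1 : ((i * u : ℝ) : WithTop ℝ) ≤ (weightSeries k z (a i)).orderTop :=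
    le_orderTop_weightSeries z (hJ i hi1 _ (ha i hi))
  have h2 : (((n - i) • R.order : ℝ) : WithTop ℝ) = (R ^ (n - i)).orderTop := by
    rw [← HahnSeries.order_pow, HahnSeries.order_eq_orderTop_of_ne_zero (pow_ne_zero _ hR0)]
  rw [← h2]
  refine lt_of_lt_of_le ?_ (add_le_add_left h1 _)
  rw [← WithTop.coe_add, WithTop.coe_lt_coe, nsmul_eq_mul, nsmul_eq_mul, Nat.cast_sub hin]
  have : (1 : ℝ) ≤ i := by exact_mod_cast hi1
  nlinarith

end WeightGrading

section NewtonPolyhedron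

variable [Fintype V] [Fintype E]

/-- The Newton polyhedron of the `t`-th power of a monomial ideal. -/
def newtonPolyhedron (m : E → V →₀ ℕ) (t : ℝ) : Set (V → ℝ) :=
  {x | ∃ c : E → ℝ, 0 ≤ c ∧ ∑ e, c e = t ∧ ∀ v, ∑ e, c e * m e v ≤ x v}

omit [Fintype V] in
theorem convex_newtonPolyhedron (m : E → V →₀ ℕ) (t : ℝ) : Convex ℝ (newtonPolyhedron m t) := by
  rintro x ⟨c, hc, hct, hcx⟩ y ⟨d, hd, hdt, hdy⟩ α β hα hβ hαβ
  refine ⟨α • c + β • d, add_nonneg (smul_nonneg hα hc) (smul_nonneg hβ hd), ?_, fun v => ?_⟩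
  · simp only [Pi.add_apply, Pi.smul_apply, smul_eq_mul, sum_add_distrib, ← mul_sum, hct, hdt]
    rw [← add_mul, hαβ, one_mul]
  · simp only [Pi.add_apply, Pi.smul_apply, smul_eq_mul, add_mul, sum_add_distrib, mul_assoc,
      ← mul_sum]
    exact add_le_add (mul_le_mul_of_nonneg_left (hcx v) hα) (mul_le_mul_of_nonneg_left (hdy v) hβ)

omit [Fintype V] in
-- It is the sum of a compact set, the image of a dilated simplex, and the closed positive orthant.
theorem isClosed_newtonPolyhedron (m : E → V →₀ ℕ) (t : ℝ) :
    IsClosed (newtonPolyhedron m t) := by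
  let L : (E → ℝ) → V → ℝ := fun c v => ∑ e, c e * m e v
  have hL : Continuous L := continuous_pi fun v => continuous_finsetSum _ fun e _ =>
    (continuous_apply e).mul continuous_const
  have hK : IsCompact {c : E → ℝ | 0 ≤ c ∧ ∑ e, c e = t} := by
    refine (isCompact_Icc (a := (0 : E → ℝ)) (b := fun _ => t)).of_isClosed_subset ?_ ?_
    · exact (isClosed_le continuous_const continuous_id).inter
        (isClosed_eq (continuous_finsetSum _ fun e _ => continuous_apply e) continuous_const)
    · rintro c ⟨h0, h1⟩
      exact ⟨h0, fun e => h1 ▸ single_le_sum (fun i _ => h0 i) (mem_univ e)⟩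
  have heq : newtonPolyhedron m t = L '' {c : E → ℝ | 0 ≤ c ∧ ∑ e, c e = t} + Set.Ici (0 : V → ℝ) := by
    ext x
    rw [Set.mem_add]
    constructor
    · rintro ⟨c, hc, hct, hcx⟩
      exact ⟨L c, ⟨c, ⟨hc, hct⟩, rfl⟩, x - L c, Set.mem_Ici.mpr (sub_nonneg.mpr hcx), add_sub_cancel _ _⟩
    · rintro ⟨_, ⟨c, ⟨hc, hct⟩, rfl⟩, s, hs, rfl⟩
      exact ⟨c, hc, hct, fun v => le_add_of_nonneg_right (hs v)⟩
  rw [heq]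
  exact isClosed_Ici.add_left_of_isCompact (hK.image hL)

/-- The exponents of an element integral over a power of a monomial ideal are in the Newton
polyhedron. -/
theorem IsIntegralOverIdeal.mem_newtonPolyhedron {m : E → V →₀ ℕ} {t : ℕ}
    {r : MvPolynomial V k} (hr : IsIntegralOverIdeal (monomialIdeal k m ^ t) r) {b : V →₀ ℕ}
    (hb : b ∈ r.support) : (fun v => (b v : ℝ)) ∈ newtonPolyhedron m t := by
  classical
  by_contra hN
  obtain ⟨f, u, hfb, hfN⟩ := geometric_hahn_banach_point_closed (convex_newtonPolyhedron m t)
    (isClosed_newtonPolyhedron m t) hN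
  set z : V → ℝ := fun i => f (Pi.single i 1) with hz
  have hf : ∀ x : V → ℝ, f x = ∑ i, z i * x i := fun x => by
    conv_lhs => rw [← univ_sum_single x, map_sum]
    refine sum_congr rfl fun i _ => ?_
    have : (Pi.single i (x i) : V → ℝ) = x i • Pi.single i 1 := by
      rw [← Pi.single_smul, smul_eq_mul, mul_one]
    rw [this, map_smul, smul_eq_mul, mul_comm]
  refine absurd (hr.le_weight z u (fun i hi p hp b hb => ?_) hb) (not_le.mpr ?_)
  · rw [← pow_mul] at hp
    obtain ⟨c, hc, hcb⟩ := mem_monomialIdeal_pow.mp hp b hb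
    have hi0 : (0 : ℝ) < i := by exact_mod_cast hi
    -- An exponent of the `i`-th power, divided by `i`, is a point of the polyhedron for `t`, where
    -- the separating functional exceeds `u`.
    have hmem : (fun v => (i : ℝ)⁻¹ * b v) ∈ newtonPolyhedron m t := by
      refine ⟨fun e => (i : ℝ)⁻¹ * c e, fun e => by positivity, ?_, fun v => ?_⟩
      · rw [← mul_sum, ← Nat.cast_sum, hc]
        push_cast
        field_simp
      · simp only [mul_assoc, ← mul_sum]
        refine mul_le_mul_of_nonneg_left ?_ (by positivity)
        have := hcb v
        rw [Finsupp.finsetSum_apply] at this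
        simp only [Finsupp.smul_apply, smul_eq_mul] at this
        exact_mod_cast this
    have h1 := (hfN _ hmem).le
    rw [hf] at h1
    have h2 : ∑ j, z j * ((i : ℝ)⁻¹ * b j) = (i : ℝ)⁻¹ * ∑ j, z j * b j := by
      rw [mul_sum]
      exact sum_congr rfl fun j _ => by ring
    rw [h2, le_inv_mul_iff₀ hi0] at h1
    exact h1
  · rw [← hf]
    exact hfb

end NewtonPolyhedron

end MonomialIdeal

/-! ### Induced odd cycles in graphs that are not bipartite -/

section OddCycle

open SimpleGraph

theorem SimpleGraph.Walk.exists_segment {V : Type*} {G : SimpleGraph V} {u v : V} (p : G.Walk u v)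
    {i j : ℕ} (hij : i ≤ j) (hj : j ≤ p.length) :
    ∃ q : G.Walk (p.getVert i) (p.getVert j), q.length = j - i := by
  refine ⟨((p.drop i).take (j - i)).copy rfl ?_, ?_⟩
  · rw [Walk.drop_getVert]
    congr 1
    omega
  · rw [Walk.length_copy, Walk.take_length, Walk.drop_length]
    omega

/-- A graph that is not bipartite has an induced odd cycle. -/
theorem SimpleGraph.exists_odd_cycleGraph_embedding {V : Type*} {G : SimpleGraph V}
    (h : ¬ G.Colorable 2) : ∃ k, 1 ≤ k ∧ Nonempty (cycleGraph (2 * k + 1) ↪g G) := by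
  classical
  rw [two_colorable_iff_forall_loop_even] at h
  push Not at h
  have hex : ∃ n, ∃ u, ∃ p : G.Walk u u, Odd p.length ∧ p.length = n := by
    obtain ⟨u, p, hp⟩ := h
    exact ⟨_, u, p, Nat.not_even_iff_odd.mp hp, rfl⟩
  obtain ⟨u, p, hodd, hlen⟩ := Nat.find_spec hex
  have hmin : ∀ x, ∀ q : G.Walk x x, q.length < p.length → Even q.length := fun x q hq => by
    by_contra hne
    rw [hlen] at hq
    exact Nat.find_min hex hq ⟨x, q, Nat.not_even_iff_odd.mp hne, rfl⟩
  clear hlen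
  obtain ⟨k, hk⟩ := hodd
  have hk1 : 1 ≤ k := by
    by_contra hk0
    have h1 : p.length = 1 := by omega
    exact (p.adj_of_length_eq_one h1).ne rfl
  -- The complementary arc, through the base point. The two arcs between `i` and `j` have lengths of
  -- opposite parity, as `p` is odd.
  have hrest : ∀ i j, i ≤ j → j ≤ p.length → ∃ q : G.Walk (p.getVert j) (p.getVert i),
      q.length = p.length - (j - i) := fun i j hij hj => by
    refine ⟨(p.drop j).append (p.take i), ?_⟩
    rw [Walk.length_append, Walk.drop_length, Walk.take_length]
    omega
  -- A repeated vertex splits the shortest odd closed walk into two shorter closed walks, one of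
  -- them odd.
  have hne : ∀ i j, i < j → j < p.length → p.getVert i ≠ p.getVert j := fun i j hij hj heq => by
    obtain ⟨q, hq⟩ := p.exists_segment hij.le hj.le
    obtain ⟨q', hq'⟩ := hrest i j hij.le hj.le
    have h1 := hmin _ (q.copy rfl heq.symm) (by rw [Walk.length_copy]; omega)
    have h2 := hmin _ (q'.copy rfl heq) (by rw [Walk.length_copy]; omega)
    rw [Walk.length_copy, hq, Nat.even_iff] at h1
    rw [Walk.length_copy, hq', Nat.even_iff] at h2
    omega
  -- A chord closes both arcs to shorter closed walks, one of them odd.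
  have hadj : ∀ i j, i < j → j < p.length →
      (G.Adj (p.getVert i) (p.getVert j) ↔ j - i = 1 ∨ j - i = p.length - 1) :=
    fun i j hij hj => by
      constructor
      · intro ha
        by_contra! hcon
        obtain ⟨q, hq⟩ := p.exists_segment hij.le hj.le
        obtain ⟨q', hq'⟩ := hrest i j hij.le hj.le
        have h1 := hmin _ (q.concat ha.symm) (by rw [Walk.length_concat]; omega)
        have h2 := hmin _ (q'.concat ha) (by rw [Walk.length_concat]; omega)
        rw [Walk.length_concat, hq, Nat.even_iff] at h1
        rw [Walk.length_concat, hq', Nat.even_iff] at h2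
        omega
      · rintro (h1 | h1)
        · have := p.adj_getVert_succ (i := i) (by omega)
          rwa [show i + 1 = j by omega] at this
        · have := p.adj_getVert_succ (i := j) hj
          rw [show j + 1 = p.length by omega, p.getVert_length] at this
          rw [show i = 0 by omega, p.getVert_zero]
          exact this.symm
  refine ⟨k, hk1, ⟨⟨⟨fun i => p.getVert i, fun i j hij => ?_⟩, fun {i j} => ?_⟩⟩⟩
  · by_contra hij'
    rcases lt_or_gt_of_ne (Fin.val_ne_of_ne hij') with hlt | hlt
    · exact hne i j hlt (by omega) hij
    · exact hne j i hlt (by omega) hij.symm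
  · change G.Adj (p.getVert i) (p.getVert j) ↔ _
    rw [cycleGraph_adj']
    rcases lt_trichotomy i j with hlt | rfl | hlt
    · rw [hadj i j hlt (by omega), Fin.coe_sub_iff_lt.mpr hlt, Fin.coe_sub_iff_le.mpr hlt.le]
      have : (i : ℕ) < j := hlt
      omega
    · simp
    · rw [G.adj_comm, hadj j i hlt (by omega), Fin.coe_sub_iff_lt.mpr hlt,
        Fin.coe_sub_iff_le.mpr hlt.le]
      have : (j : ℕ) < i := hlt
      omega

/-- A set of vertices that induces a graph that is not bipartite contains an induced odd cycle. -/
theorem IsOddSet.exists_cycle {V : Type*} {G : SimpleGraph V} {U : Set V}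
    (h : IsOddSet (fun e : G.edgeSet => (e : Sym2 V)) U) :
    ∃ k, 1 ≤ k ∧ ∃ f : cycleGraph (2 * k + 1) ↪g G, ∀ i, f i ∈ U := by
  classical
  obtain ⟨k, hk, ⟨f⟩⟩ := SimpleGraph.exists_odd_cycleGraph_embedding (G := G.induce U) (by
    rintro ⟨σ⟩
    refine h ⟨fun v => if hv : v ∈ U then decide (σ ⟨v, hv⟩ = 0) else true, ?_⟩
    intro e a b he ha hb
    have hadj : (G.induce U).Adj ⟨a, ha⟩ ⟨b, hb⟩ := by
      have := e.2
      simp only at he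
      rw [he] at this
      exact this
    have hσ := σ.valid hadj
    simp only [dif_pos ha, dif_pos hb]
    intro heq
    rw [decide_eq_decide] at heq
    omega)
  exact ⟨k, hk, f.trans (Embedding.induce U), fun i => (f i).2⟩

end OddCycle

/-! ### Heavy and light adjacency; the configurations as embeddings -/

namespace EdgeWeightedGraph

open SimpleGraph

variable {V : Type*} (G : EdgeWeightedGraph V)

/-- The pairs of vertices that are joined by an edge of weight greater than one. -/
def HeavyAdj (u v : V) : Prop := ∃ h : G.graph.Adj u v, 1 < (G.weight ⟨s(u, v), h⟩ : ℕ)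

/-- The pairs of vertices that are joined by an edge of weight one. -/
def LightAdj (u v : V) : Prop := ∃ h : G.graph.Adj u v, (G.weight ⟨s(u, v), h⟩ : ℕ) = 1

variable {G}

theorem weight_congr {u v u' v' : V} (h : G.graph.Adj u v) (h' : G.graph.Adj u' v')
    (heq : s(u, v) = s(u', v')) : G.weight ⟨s(u, v), h⟩ = G.weight ⟨s(u', v'), h'⟩ :=
  congrArg G.weight (Subtype.ext heq)

theorem HeavyAdj.symm {u v : V} (h : G.HeavyAdj u v) : G.HeavyAdj v u := by
  obtain ⟨h, hw⟩ := h
  exact ⟨h.symm, by rwa [weight_congr h.symm h Sym2.eq_swap]⟩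

theorem LightAdj.symm {u v : V} (h : G.LightAdj u v) : G.LightAdj v u := by
  obtain ⟨h, hw⟩ := h
  exact ⟨h.symm, by rwa [weight_congr h.symm h Sym2.eq_swap]⟩

theorem HeavyAdj.ne {u v : V} (h : G.HeavyAdj u v) : u ≠ v := h.1.ne

theorem HeavyAdj.not_lightAdj {u v : V} (h : G.HeavyAdj u v) : ¬ G.LightAdj u v :=
  fun h' => by
    have := h.2
    rw [h'.2] at this
    omega

theorem heavyAdj_or_lightAdj {u v : V} (h : G.graph.Adj u v) : G.HeavyAdj u v ∨ G.LightAdj u v := by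
  have := (G.weight ⟨s(u, v), h⟩).pos
  rcases Nat.lt_or_ge 1 (G.weight ⟨s(u, v), h⟩ : ℕ) with h1 | h1
  · exact Or.inl ⟨h, h1⟩
  · exact Or.inr ⟨h, by omega⟩

/-- An induced subgraph isomorphic to `H` with all weights greater than one is an embedding of `H`
whose edges have weight greater than one. -/
theorem exists_induce_iso_iff {W : Type*} (H : SimpleGraph W) :
    (∃ s : Set V, Nonempty ((G.induce s).graph ≃g H) ∧
      ∀ e : (G.induce s).graph.edgeSet, 1 < (G.induce s).weight e) ↔
    ∃ f : H ↪g G.graph, ∀ i j, H.Adj i j → G.HeavyAdj (f i) (f j) := by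
  constructor
  · rintro ⟨s, ⟨φ⟩, hw⟩
    refine ⟨(φ.symm.toEmbedding).trans (Embedding.induce s), fun i j hij => ?_⟩
    have h := φ.symm.map_adj_iff.mpr hij
    exact ⟨h, hw ⟨s(φ.symm i, φ.symm j), h⟩⟩
  · rintro ⟨f, hf⟩
    refine ⟨Set.range f, ⟨f.isoInduceRange.symm⟩, ?_⟩
    rintro ⟨e, he⟩
    induction e with
    | h a b =>
      obtain ⟨_, i, rfl⟩ := a
      obtain ⟨_, j, rfl⟩ := b
      obtain ⟨h, hw⟩ := hf i j (f.map_adj_iff.mp he)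
      exact hw

theorem exists_isF4_iff :
    (∃ s : Set V, (G.induce s).IsF4) ↔ ∃ k, 1 ≤ k ∧
      ∃ f : cycleGraph (2 * k + 1) ↪g G.graph, ∃ a b, G.HeavyAdj a b ∧
        ∀ i, f i ≠ a ∧ f i ≠ b ∧ ¬ G.graph.Adj (f i) a ∧ ¬ G.graph.Adj (f i) b := by
  constructor
  · rintro ⟨s, k, hk, φ, hw⟩
    have hadj : ∀ x y, G.graph.Adj (φ x : V) (φ y) ↔
        (cycleGraph (2 * k + 1) ⊕g pathGraph 2).Adj x y := fun x y => φ.map_adj_iff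
    have hne : ∀ i (j : Fin 2), (φ (Sum.inl i) : V) ≠ φ (Sum.inr j) := fun i j h => by
      have := φ.injective (Subtype.ext h)
      simp at this
    have h01 : G.graph.Adj (φ (Sum.inr 0) : V) (φ (Sum.inr 1)) := by
      rw [hadj]
      simp [pathGraph_adj]
    refine ⟨k, hk, (Embedding.sumInl.trans φ.toEmbedding).trans (Embedding.induce s),
      φ (Sum.inr 0), φ (Sum.inr 1), ⟨h01, hw h01⟩, fun i => ⟨hne i 0, hne i 1, ?_, ?_⟩⟩
    · intro h
      have := (hadj (Sum.inl i) (Sum.inr 0)).mp h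
      simp at this
    · intro h
      have := (hadj (Sum.inl i) (Sum.inr 1)).mp h
      simp at this
  · rintro ⟨k, hk, f, a, b, hab, hf⟩
    have hinj : Function.Injective (Sum.elim f ![a, b]) := by
      refine f.injective.sumElim (fun i j h => ?_) fun i j => ?_
      · have := hab.ne
        fin_cases i <;> fin_cases j <;> simp_all
      · fin_cases j
        · exact (hf i).1
        · exact (hf i).2.1
    have hadj : ∀ x y, G.graph.Adj (Sum.elim f ![a, b] x) (Sum.elim f ![a, b] y) ↔
        (cycleGraph (2 * k + 1) ⊕g pathGraph 2).Adj x y := by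
      rintro (i | i) (j | j)
      · exact f.map_adj_iff
      · fin_cases j
        · simpa using (hf i).2.2.1
        · simpa using (hf i).2.2.2
      · fin_cases i
        · simpa [G.graph.adj_comm] using (hf j).2.2.1
        · simpa [G.graph.adj_comm] using (hf j).2.2.2
      · have := hab.1
        fin_cases i <;> fin_cases j <;> simp [pathGraph_adj, this, this.symm]
    let g : (cycleGraph (2 * k + 1) ⊕g pathGraph 2) ↪g G.graph :=
      ⟨⟨Sum.elim f ![a, b], hinj⟩, fun {x y} => hadj x y⟩
    exact ⟨Set.range g, k, hk, g.isoInduceRange, fun h => hab.2⟩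

theorem exists_isF5_iff :
    (∃ s : Set V, (G.induce s).IsF5) ↔ ∃ k l, 1 ≤ k ∧ 1 ≤ l ∧
      ∃ (f : cycleGraph (2 * k + 1) ↪g G.graph) (g : cycleGraph (2 * l + 1) ↪g G.graph),
        ∀ i j, f i ≠ g j ∧ (G.graph.Adj (f i) (g j) → G.HeavyAdj (f i) (g j)) := by
  constructor
  · rintro ⟨s, k, l, hk, hl, φ, h1, h2, h3⟩
    refine ⟨k, l, hk, hl,
      ⟨⟨fun i => φ (Sum.inl i), fun i j h => ?_⟩, fun {i j} => h1 i j⟩,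
      ⟨⟨fun i => φ (Sum.inr i), fun i j h => ?_⟩, fun {i j} => h2 i j⟩,
      fun i j => ⟨fun h => ?_, fun h => ⟨h, h3 i j h⟩⟩⟩
    · exact Sum.inl_injective (φ.injective (Subtype.ext h))
    · exact Sum.inr_injective (φ.injective (Subtype.ext h))
    · have := φ.injective (Subtype.ext h)
      simp at this
  · rintro ⟨k, l, hk, hl, f, g, hfg⟩
    have hinj : Function.Injective (Sum.elim f g) :=
      f.injective.sumElim g.injective fun i j => (hfg i j).1
    refine ⟨Set.range (Sum.elim f g), k, l, hk, hl, Equiv.ofInjective _ hinj,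
      fun i j => f.map_adj_iff, fun i j => g.map_adj_iff, fun i j h => ?_⟩
    exact ((hfg i j).2 h).2

end EdgeWeightedGraph

/-! ### What normality gives for half-integral combinations -/

section NormalMonomial

open Finset MvPolynomial

/-- The product of the `2 * t` chosen generators divides `x ^ (2 b)`, which therefore lies in `(I ^
t) ^ 2`. So `r = x ^ b` satisfies the integral equation `r ^ 2 - x ^ (2 b) = 0`, and normality puts
it in `I ^ t`. -/
theorem IsNormalIdeal.exists_exponents {k V E : Type*} [Field k] [Fintype E] {m : E → V →₀ ℕ}
    (h : IsNormalIdeal (monomialIdeal k m)) {t : ℕ} (ht : 1 ≤ t) {ι : Type*} [Fintype ι]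
    (g : ι → E) (hcard : Fintype.card ι = 2 * t) {b : V →₀ ℕ} (hb : ∑ i, m (g i) ≤ 2 • b) :
    ∃ c : E → ℕ, ∑ e, c e = t ∧ ∑ e, c e • m e ≤ b := by
  classical
  have hsq : (monomial b (1 : k)) ^ 2 ∈ monomialIdeal k m ^ (2 * t) := by
    obtain ⟨b', hb'⟩ := le_iff_exists_add.mp hb
    have h1 : ∏ i, monomial (m (g i)) (1 : k) ∈ ∏ _i : ι, monomialIdeal k m :=
      Ideal.prod_mem_prod fun i _ => Ideal.subset_span ⟨g i, rfl⟩
    rw [prod_const, card_univ, hcard] at h1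
    rw [monomial_pow, one_pow, hb', ← one_mul (1 : k), ← monomial_mul, ← prod_monomial_one]
    exact Ideal.mul_mem_right _ _ h1
  have hint : monomial b (1 : k) ∈ idealIntegralClosure (monomialIdeal k m ^ t) := by
    refine ⟨2, by norm_num, fun i => if i = 2 then -(monomial b (1 : k)) ^ 2 else 0, ?_, ?_⟩
    · intro i _
      dsimp only
      split_ifs with hi
      · rw [hi, ← pow_mul, mul_comm t 2]
        exact neg_mem hsq
      · exact zero_mem _
    · rw [sum_eq_single 2]
      · simp
      · intro i _ hi
        simp only [if_neg hi, zero_mul]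
      · intro h
        simp at h
  rw [← h t ht] at hint
  exact mem_monomialIdeal_pow.mp hint b (by
    rw [support_monomial, if_neg one_ne_zero]
    exact mem_singleton_self b)

end NormalMonomial

/-! ### The edge ideal as a monomial ideal; normality and pairs of heavy edges -/

namespace EdgeWeightedGraph

open SimpleGraph Finset

open scoped Classical in
/-- The exponent of the generator of the edge ideal that belongs to an edge. -/
noncomputable def edgeExponent {V : Type*} [Fintype V] (G : EdgeWeightedGraph V)
    (e : G.graph.edgeSet) : V →₀ ℕ :=
  Finsupp.equivFunOnFinite.symm fun v => if v ∈ (e : Sym2 V) then (G.weight e : ℕ) else 0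

variable {V : Type*} [Fintype V] {G : EdgeWeightedGraph V}

theorem edgeExponent_of_mem {e : G.graph.edgeSet} {v : V} (h : v ∈ (e : Sym2 V)) :
    G.edgeExponent e v = G.weight e := by
  simp [edgeExponent, h]

theorem edgeExponent_of_notMem {e : G.graph.edgeSet} {v : V} (h : v ∉ (e : Sym2 V)) :
    G.edgeExponent e v = 0 := by
  simp [edgeExponent, h]

theorem edgeIdeal_eq (k : Type*) [Field k] : G.edgeIdeal k = monomialIdeal k G.edgeExponent := by
  classical
  have hmon : ∀ i j (h : G.graph.Adj i j), (MvPolynomial.X i * MvPolynomial.X j : MvPolynomial V k)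
      ^ (G.weight ⟨s(i, j), h⟩ : ℕ) = MvPolynomial.monomial (G.edgeExponent ⟨s(i, j), h⟩) 1 := by
    intro i j h
    rw [MvPolynomial.X, MvPolynomial.X, MvPolynomial.monomial_mul, MvPolynomial.monomial_pow]
    simp only [mul_one, one_pow]
    refine congrArg (fun b => MvPolynomial.monomial b (1 : k)) (Finsupp.ext fun v => ?_)
    have hij := h.ne
    simp only [edgeExponent, Finsupp.smul_apply, Finsupp.add_apply, Finsupp.single_apply,
      Finsupp.equivFunOnFinite_symm_apply_apply, Sym2.mem_iff, smul_eq_mul]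
    by_cases h1 : i = v
    · subst h1
      simp [hij.symm]
    · by_cases h2 : j = v
      · subst h2
        simp [hij]
      · rw [if_neg h1, if_neg h2, if_neg (by rintro (h | h) <;> simp_all)]
        simp
  rw [edgeIdeal, monomialIdeal]
  congr 1
  ext p
  constructor
  · rintro ⟨i, j, h, rfl⟩
    exact ⟨⟨s(i, j), h⟩, (hmon i j h).symm⟩
  · rintro ⟨⟨e, he⟩, rfl⟩
    induction e with
    | h i j => exact ⟨i, j, he, (hmon i j he).symm⟩

/-- An integral packing that normality produces from a half-integral one. -/
theorem exists_packing_of_normal [Fintype G.graph.edgeSet] {k : Type*} [Field k]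
    (h : IsNormalIdeal (G.edgeIdeal k)) {t : ℕ} (ht : 1 ≤ t) {ι : Type*} [Fintype ι]
    (g : ι → G.graph.edgeSet) (hcard : Fintype.card ι = 2 * t) (b : V → ℕ)
    (hb : ∀ v, ∑ i, G.edgeExponent (g i) v ≤ 2 * b v) :
    ∃ c : G.graph.edgeSet → ℕ, ∑ e, c e = t ∧ (∀ v, ∑ e, c e * G.edgeExponent e v ≤ b v) ∧
      ∀ e, c e ≠ 0 → ∀ v ∈ (e : Sym2 V), (G.weight e : ℕ) ≤ b v := by
  rw [edgeIdeal_eq] at h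
  obtain ⟨c, hc, hcb⟩ := h.exists_exponents ht g hcard (b := Finsupp.equivFunOnFinite.symm b) (by
    intro v
    simpa [Finsupp.finsetSum_apply] using hb v)
  have hle : ∀ v, ∑ e, c e * G.edgeExponent e v ≤ b v := fun v => by
    simpa [Finsupp.finsetSum_apply] using hcb v
  refine ⟨c, hc, hle, fun e he v hv => ?_⟩
  refine le_trans ?_ ((single_le_sum (f := fun e => c e * G.edgeExponent e v)
    (fun _ _ => Nat.zero_le _) (mem_univ e)).trans (hle v))
  rw [edgeExponent_of_mem hv]
  exact Nat.le_mul_of_pos_left _ (Nat.pos_of_ne_zero he)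

section HeavyPair

variable {k : Type*} [Field k]

/-- Two edges of weight greater than one produce a third edge on their vertices. -/
theorem exists_edge_of_normal (h : IsNormalIdeal (G.edgeIdeal k)) (e f : G.graph.edgeSet) :
    ∃ g : G.graph.edgeSet, ∀ v ∈ (g : Sym2 V),
      (G.weight g : ℕ) ≤ (G.edgeExponent e v + G.edgeExponent f v + 1) / 2 := by
  classical
  obtain ⟨c, hc, -, hle⟩ := exists_packing_of_normal h le_rfl ![e, f] (by simp)
    (fun v => (G.edgeExponent e v + G.edgeExponent f v + 1) / 2) (fun v => by
      rw [Fin.sum_univ_two]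
      simp only [Matrix.cons_val_zero, Matrix.cons_val_one]
      omega)
  obtain ⟨g, -, hg⟩ := exists_ne_zero_of_sum_ne_zero (hc.trans_ne one_ne_zero)
  exact ⟨g, hle g hg⟩

/-- The capacity at `a` and at `c` is half the weight of its edge, rounded up, which is smaller than
that weight because the edge is heavy. So neither given edge fits, and capacity zero elsewhere
leaves only the pair `a`, `c`. -/
theorem weight_edge_lt_of_normal (h : IsNormalIdeal (G.edgeIdeal k)) {a b c : V} (hac : a ≠ c)
    (hab : G.HeavyAdj a b) (hbc : G.HeavyAdj b c) : ∃ hadj : G.graph.Adj a c,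
      (G.weight ⟨s(a, c), hadj⟩ : ℕ) < G.weight ⟨s(a, b), hab.1⟩ ∧
      (G.weight ⟨s(a, c), hadj⟩ : ℕ) < G.weight ⟨s(b, c), hbc.1⟩ := by
  obtain ⟨⟨e, he⟩, hg⟩ := exists_edge_of_normal h ⟨s(a, b), hab.1⟩ ⟨s(b, c), hbc.1⟩
  have hpos := (G.weight ⟨e, he⟩).pos
  have h1 := hab.2
  have h2 := hbc.2
  have hnab := hab.ne
  have hnbc := hbc.ne
  simp only at hg
  have ha : a ∈ e → (G.weight ⟨e, he⟩ : ℕ) < G.weight ⟨s(a, b), hab.1⟩ := fun ha => by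
    have := hg a ha
    rw [edgeExponent_of_mem (Sym2.mem_mk_left a b), edgeExponent_of_notMem (by simp [hnab, hac])]
      at this
    omega
  have hc : c ∈ e → (G.weight ⟨e, he⟩ : ℕ) < G.weight ⟨s(b, c), hbc.1⟩ := fun hc => by
    have := hg c hc
    rw [edgeExponent_of_notMem (by simp [hnbc.symm, hac.symm]),
      edgeExponent_of_mem (Sym2.mem_mk_right b c)] at this
    omega
  have hmem : ∀ v ∈ e, v = a ∨ v = b ∨ v = c := fun v hv => by
    by_contra! hcon
    have := hg v hv
    rw [edgeExponent_of_notMem (by simp [hcon]), edgeExponent_of_notMem (by simp [hcon])] at this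
    omega
  have hane : a ∈ e → e ≠ s(a, b) := fun ha' heq => by
    subst heq
    exact (ha ha').ne rfl
  have hcne : c ∈ e → e ≠ s(b, c) := fun hc' heq => by
    subst heq
    exact (hc hc').ne rfl
  have hboth : e = s(a, c) := by
    induction e with
    | h p q =>
      have hpq : p ≠ q := G.graph.ne_of_adj he
      rcases hmem p (Sym2.mem_mk_left p q) with rfl | rfl | rfl <;>
        rcases hmem q (Sym2.mem_mk_right p q) with rfl | rfl | rfl <;> simp_all [Sym2.eq_swap]
  subst hboth
  exact ⟨he, ha (Sym2.mem_mk_left a c), hc (Sym2.mem_mk_right a c)⟩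

/-- In a heavy triangle, the strict inequality for the path `a b c` and the one for the path `b a c`
contradict each other. -/
theorem lightAdj_of_normal (h : IsNormalIdeal (G.edgeIdeal k)) {a b c : V} (hac : a ≠ c)
    (hab : G.HeavyAdj a b) (hbc : G.HeavyAdj b c) : G.LightAdj a c := by
  obtain ⟨hadj, h1, h2⟩ := weight_edge_lt_of_normal h hac hab hbc
  refine (heavyAdj_or_lightAdj hadj).resolve_left fun hheavy => ?_
  obtain ⟨_, -, h3⟩ := weight_edge_lt_of_normal h hbc.ne hab.symm hheavy
  exact h2.asymm h3

/-- Halving and rounding up the exponents leaves too little capacity for either given edge, so the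
edge provided by normality runs between the two pairs. -/
theorem exists_adj_of_normal (h : IsNormalIdeal (G.edgeIdeal k)) {a b c d : V}
    (hab : G.HeavyAdj a b) (hcd : G.HeavyAdj c d) (hac : a ≠ c) (had : a ≠ d) (hbc : b ≠ c)
    (hbd : b ≠ d) : G.graph.Adj a c ∨ G.graph.Adj a d ∨ G.graph.Adj b c ∨ G.graph.Adj b d := by
  by_contra! hno
  obtain ⟨hno1, hno2, hno3, hno4⟩ := hno
  obtain ⟨⟨e, he⟩, hg⟩ := exists_edge_of_normal h ⟨s(a, b), hab.1⟩ ⟨s(c, d), hcd.1⟩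
  have hpos := (G.weight ⟨e, he⟩).pos
  have h1 := hab.2
  have h2 := hcd.2
  simp only at hg
  have hmem : ∀ v ∈ e, v = a ∨ v = b ∨ v = c ∨ v = d := fun v hv => by
    by_contra! hcon
    have := hg v hv
    rw [edgeExponent_of_notMem (by simp [hcon]), edgeExponent_of_notMem (by simp [hcon])] at this
    omega
  have heab : e ≠ s(a, b) := fun heq => by
    subst heq
    have := hg a (Sym2.mem_mk_left a b)
    rw [edgeExponent_of_mem (Sym2.mem_mk_left a b), edgeExponent_of_notMem (by simp [hac, had])]
      at this
    omega
  have hecd : e ≠ s(c, d) := fun heq => by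
    subst heq
    have := hg c (Sym2.mem_mk_left c d)
    rw [edgeExponent_of_notMem (by simp [hac.symm, hbc.symm]),
      edgeExponent_of_mem (Sym2.mem_mk_left c d)] at this
    omega
  induction e with
  | h p q =>
    have hadj : G.graph.Adj p q := he
    have hadj' := hadj.symm
    have hpq : p ≠ q := hadj.ne
    rcases hmem p (Sym2.mem_mk_left p q) with rfl | rfl | rfl | rfl <;>
      rcases hmem q (Sym2.mem_mk_right p q) with rfl | rfl | rfl | rfl <;>
      first
      | contradiction
      | exact heab Sym2.eq_swap
      | exact hecd Sym2.eq_swap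

end HeavyPair

end EdgeWeightedGraph

/-! ### Normality and induced odd cycles -/

namespace EdgeWeightedGraph

open SimpleGraph Finset

open scoped Classical

variable {V : Type*} [Fintype V] {G : EdgeWeightedGraph V}

theorem cycleGraph_adj_add_one {k : ℕ} (hk : 1 ≤ k) (i : Fin (2 * k + 1)) :
    (cycleGraph (2 * k + 1)).Adj i (i + 1) := by
  rw [cycleGraph_adj', add_sub_cancel_left]
  right
  rw [Fin.val_one', Nat.mod_eq_of_lt (by omega)]

/-- The `i`-th edge of an embedded cycle. -/
def cycleEdge {k : ℕ} (hk : 1 ≤ k) (f : cycleGraph (2 * k + 1) ↪g G.graph)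
    (i : Fin (2 * k + 1)) : G.graph.edgeSet :=
  ⟨s(f i, f (i + 1)), f.map_adj_iff.mpr (cycleGraph_adj_add_one hk i)⟩

/-- Each vertex of the cycle lies on two of its edges, all of weight one, so half of the sum is an
integral exponent although the number of edges is odd. -/
theorem sum_edgeExponent_cycleEdge {k : ℕ} (hk : 1 ≤ k) (f : cycleGraph (2 * k + 1) ↪g G.graph)
    (hlight : ∀ i j, (cycleGraph (2 * k + 1)).Adj i j → G.LightAdj (f i) (f j)) (v : V) :
    ∑ i, G.edgeExponent (cycleEdge hk f i) v = 2 * if v ∈ univ.image f then 1 else 0 := by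
  have h1 : ∀ i, G.edgeExponent (cycleEdge hk f i) v =
      (if v = f i then 1 else 0) + if v = f (i + 1) then 1 else 0 := fun i => by
    have hadj := cycleGraph_adj_add_one hk i
    have hne : f i ≠ f (i + 1) := (f.map_adj_iff.mpr hadj).ne
    obtain ⟨_, hw⟩ := hlight i (i + 1) hadj
    by_cases hv : v ∈ (cycleEdge hk f i : Sym2 V)
    · rw [edgeExponent_of_mem hv]
      rcases Sym2.mem_iff.mp hv with rfl | rfl
      · rw [if_pos rfl, if_neg hne]
        exact hw
      · rw [if_neg hne.symm, if_pos rfl]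
        exact hw
    · rw [edgeExponent_of_notMem hv]
      have := fun h => hv (Sym2.mem_iff.mpr h)
      rw [if_neg fun h => this (Or.inl h), if_neg fun h => this (Or.inr h)]
  have h2 : (∑ i, if v = f i then 1 else 0) = if v ∈ univ.image f then 1 else 0 := by
    split_ifs with hv
    · obtain ⟨j, -, rfl⟩ := mem_image.mp hv
      rw [sum_eq_single j (fun i _ hij => if_neg fun h => hij (f.injective h).symm) (by simp),
        if_pos rfl]
    · exact sum_eq_zero fun i _ => if_neg fun h => hv (mem_image.mpr ⟨i, mem_univ i, h.symm⟩)
  have h3 : (∑ i, if v = f (i + 1) then 1 else 0) = ∑ i, if v = f i then 1 else 0 :=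
    Equiv.sum_comp (Equiv.addRight (1 : Fin (2 * k + 1))) fun i => if v = f i then 1 else 0
  simp only [h1]
  rw [sum_add_distrib, h3, h2]
  exact (two_mul _).symm

/-- Weights are positive, so every edge inside `U` uses at least two units of the capacity of `U`.
-/
theorem two_mul_sum_le (U : Finset V) {c : G.graph.edgeSet → ℕ} {b : V → ℕ}
    (hc : ∀ v, ∑ e, c e * G.edgeExponent e v ≤ b v) :
    2 * ∑ e ∈ univ.filter (fun e : G.graph.edgeSet => ∀ v ∈ (e : Sym2 V), v ∈ U), c e ≤
      ∑ v ∈ U, b v := by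
  refine le_trans ?_ (sum_le_sum fun v _ => hc v)
  rw [sum_comm, mul_sum]
  refine le_trans (sum_le_sum (g := fun e => ∑ v ∈ U, c e * G.edgeExponent e v) fun e he => ?_)
    (sum_le_sum_of_subset (filter_subset _ _))
  rw [← mul_sum, mul_comm]
  refine Nat.mul_le_mul_left _ ?_
  have hU := (mem_filter.mp he).2
  obtain ⟨e, hE⟩ := e
  induction e with
  | h p q =>
    have hpq : p ≠ q := G.graph.ne_of_adj hE
    have hsub : ({p, q} : Finset V) ⊆ U := by
      intro v hv
      rw [mem_insert, mem_singleton] at hv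
      exact hU v (Sym2.mem_iff.mpr hv)
    refine le_trans ?_ (sum_le_sum_of_subset hsub)
    rw [sum_pair hpq, edgeExponent_of_mem (Sym2.mem_mk_left p q),
      edgeExponent_of_mem (Sym2.mem_mk_right p q)]
    have := (G.weight ⟨s(p, q), hE⟩).pos
    omega

omit [Fintype V] in
theorem card_image_cycle {k : ℕ} (f : cycleGraph (2 * k + 1) ↪g G.graph) :
    (univ.image f).card = 2 * k + 1 := by
  rw [card_image_of_injective _ f.injective, card_fin]

variable {k : Type*} [Field k]

/-- If the edge ideal is normal, an induced odd cycle and an edge of weight greater than one meet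
or are joined by an edge. -/
theorem exists_cycle_adj_of_normal (h : IsNormalIdeal (G.edgeIdeal k)) {n : ℕ} (hn : 1 ≤ n)
    (f : cycleGraph (2 * n + 1) ↪g G.graph) {a b : V} (hab : G.HeavyAdj a b)
    (hfab : ∀ i, f i ≠ a ∧ f i ≠ b) : ∃ i, G.graph.Adj (f i) a ∨ G.graph.Adj (f i) b := by
  by_contra! hno
  have hlight : ∀ i j, (cycleGraph (2 * n + 1)).Adj i j → G.LightAdj (f i) (f j) :=
    fun i j hij => (heavyAdj_or_lightAdj (f.map_adj_iff.mpr hij)).resolve_left fun hh => by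
      have := exists_adj_of_normal h hh hab (hfab i).1 (hfab i).2 (hfab j).1 (hfab j).2
      have h1 := hno i
      have h2 := hno j
      tauto
  set w : ℕ := ((G.weight ⟨s(a, b), hab.1⟩ : ℕ+) : ℕ) with hw
  have hw1 : 1 < w := hab.2
  have haU : a ∉ univ.image f := fun ha => by
    obtain ⟨i, -, hi⟩ := mem_image.mp ha
    exact (hfab i).1 hi
  have hbU : b ∉ univ.image f := fun hb => by
    obtain ⟨i, -, hi⟩ := mem_image.mp hb
    exact (hfab i).2 hi
  -- Half the sum of the cycle edges and `a b`, rounded up at `a` and `b`. As `(w + 1) / 2 < w`, the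
  -- edge `a b` does not fit, so all `n + 1` edges would lie on the cycle, whose `2 * n + 1`
  -- vertices have capacity one.
  obtain ⟨c, hc, hcb, hle⟩ := exists_packing_of_normal h (t := n + 1) (by omega)
    (ι := Fin (2 * n + 1) ⊕ Unit) (Sum.elim (cycleEdge hn f) fun _ => ⟨s(a, b), hab.1⟩)
    (by simp; ring)
    (fun v => if v ∈ univ.image f then 1 else if v = a ∨ v = b then (w + 1) / 2 else 0)
    (fun v => by
      simp only [Fintype.sum_sum_type, Sum.elim_inl, Sum.elim_inr, univ_unique, sum_singleton]
      rw [sum_edgeExponent_cycleEdge hn f hlight v]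
      by_cases hv : v ∈ univ.image f
      · have hv' : v ∉ s(a, b) := fun hv' => by
          rcases Sym2.mem_iff.mp hv' with rfl | rfl
          · exact haU hv
          · exact hbU hv
        rw [edgeExponent_of_notMem hv', if_pos hv, if_pos hv]
      · rw [if_neg hv, if_neg hv]
        by_cases hv' : v = a ∨ v = b
        · rw [edgeExponent_of_mem (Sym2.mem_iff.mpr hv'), if_pos hv', ← hw]
          omega
        · rw [edgeExponent_of_notMem fun h => hv' (Sym2.mem_iff.mp h)]
          omega)
  have hsub : ∀ e, c e ≠ 0 → ∀ v ∈ (e : Sym2 V), v ∈ univ.image f := by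
    rintro ⟨e, he⟩ hce
    have hle' := hle _ hce
    have hpos := (G.weight ⟨e, he⟩).pos
    have hmem : ∀ v ∈ e, v ∉ univ.image f → v = a ∨ v = b := fun v hv hvU => by
      have := hle' v hv
      rw [if_neg hvU] at this
      by_contra hcon
      rw [if_neg hcon] at this
      omega
    have hadj : ∀ p q, G.graph.Adj p q → p ∈ univ.image f → q ∉ univ.image f →
        ¬ (q = a ∨ q = b) := by
      rintro p q hpq hp hq (rfl | rfl) <;> obtain ⟨i, -, rfl⟩ := mem_image.mp hp
      · exact (hno i).1 hpq
      · exact (hno i).2 hpq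
    have heab : e ≠ s(a, b) := fun heq => by
      subst heq
      have := hle' a (Sym2.mem_mk_left a b)
      rw [if_neg haU, if_pos (Or.inl rfl)] at this
      omega
    induction e with
    | h p q =>
      have hpq : G.graph.Adj p q := he
      have hp := hmem p (Sym2.mem_mk_left p q)
      have hq := hmem q (Sym2.mem_mk_right p q)
      have key : p ∈ univ.image f ∧ q ∈ univ.image f := by
        by_cases h1 : p ∈ univ.image f
        · refine ⟨h1, ?_⟩
          by_contra h2
          exact hadj p q hpq h1 h2 (hq h2)
        · exfalso
          by_cases h2 : q ∈ univ.image f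
          · exact hadj q p hpq.symm h2 h1 (hp h1)
          · rcases hp h1 with rfl | rfl <;> rcases hq h2 with rfl | rfl
            · exact hpq.ne rfl
            · exact heab rfl
            · exact heab Sym2.eq_swap
            · exact hpq.ne rfl
      intro v hv
      rcases Sym2.mem_iff.mp hv with rfl | rfl
      · exact key.1
      · exact key.2
  have hcount := two_mul_sum_le (univ.image f) hcb
  rw [sum_filter_of_ne (fun e _ he => hsub e he), hc, sum_congr rfl (g := fun _ => 1) (fun v hv =>
    if_pos hv), sum_const, smul_eq_mul, mul_one, card_image_cycle] at hcount
  omega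

/-- A heavy edge of the first cycle has an edge to the second one, which is heavy by assumption. The
heavy path so formed requires a light edge between the cycles. -/
theorem cycle_light_of_normal (h : IsNormalIdeal (G.edgeIdeal k)) {n m : ℕ} (hm : 1 ≤ m)
    (f : cycleGraph (2 * n + 1) ↪g G.graph) (g : cycleGraph (2 * m + 1) ↪g G.graph)
    (hfg : ∀ i j, f i ≠ g j ∧ (G.graph.Adj (f i) (g j) → G.HeavyAdj (f i) (g j))) (i j)
    (hij : (cycleGraph (2 * n + 1)).Adj i j) : G.LightAdj (f i) (f j) := by
  refine (heavyAdj_or_lightAdj (f.map_adj_iff.mpr hij)).resolve_left fun hh => ?_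
  have key : ∀ i j, G.HeavyAdj (f i) (f j) → ∀ l, ¬ G.graph.Adj (g l) (f i) := fun i j hh l hl => by
    have h1 := (hfg i l).2 hl.symm
    have h2 := lightAdj_of_normal h (hfg j l).1 hh.symm h1
    exact ((hfg j l).2 h2.1).not_lightAdj h2
  obtain ⟨l, hl | hl⟩ := exists_cycle_adj_of_normal h hm g hh
    fun l => ⟨(hfg i l).1.symm, (hfg j l).1.symm⟩
  · exact key i j hh l hl
  · exact key j i hh.symm l hl

/-- If the edge ideal is normal, two disjoint induced odd cycles are joined by an edge of weight
one. -/
theorem not_two_cycles_of_normal (h : IsNormalIdeal (G.edgeIdeal k)) {n m : ℕ} (hn : 1 ≤ n)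
    (hm : 1 ≤ m) (f : cycleGraph (2 * n + 1) ↪g G.graph) (g : cycleGraph (2 * m + 1) ↪g G.graph)
    (hfg : ∀ i j, f i ≠ g j ∧ (G.graph.Adj (f i) (g j) → G.HeavyAdj (f i) (g j))) : False := by
  have hf := cycle_light_of_normal h hm f g hfg
  have hg := cycle_light_of_normal h hn g f fun i j =>
    ⟨(hfg j i).1.symm, fun hadj => ((hfg j i).2 hadj.symm).symm⟩
  have hdisj : Disjoint (univ.image f) (univ.image g) := by
    rw [Finset.disjoint_left]
    intro v hv hv'
    obtain ⟨i, -, rfl⟩ := mem_image.mp hv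
    obtain ⟨j, -, hj⟩ := mem_image.mp hv'
    exact (hfg i j).1 hj.symm
  -- Unit capacities on both cycles exclude the heavy edges between them, and inside the cycles at
  -- most `n` and `m` edges fit, one fewer than required.
  obtain ⟨c, hc, hcb, hle⟩ := exists_packing_of_normal h (t := n + m + 1) (by omega)
    (ι := Fin (2 * n + 1) ⊕ Fin (2 * m + 1)) (Sum.elim (cycleEdge hn f) (cycleEdge hm g))
    (by simp; ring)
    (fun v => (if v ∈ univ.image f then 1 else 0) + if v ∈ univ.image g then 1 else 0)
    (fun v => by
      simp only [Fintype.sum_sum_type, Sum.elim_inl, Sum.elim_inr]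
      rw [sum_edgeExponent_cycleEdge hn f hf v, sum_edgeExponent_cycleEdge hm g hg v, mul_add])
  have hcross : ∀ p q, p ∈ univ.image f → q ∈ univ.image g → ∀ he : G.graph.Adj p q,
      1 < (G.weight ⟨s(p, q), he⟩ : ℕ) := fun p q hp hq he => by
    obtain ⟨i, -, rfl⟩ := mem_image.mp hp
    obtain ⟨j, -, rfl⟩ := mem_image.mp hq
    exact ((hfg i j).2 he).2
  have hsub : ∀ e, c e ≠ 0 → (∀ v ∈ (e : Sym2 V), v ∈ univ.image f) ∨
      ∀ v ∈ (e : Sym2 V), v ∈ univ.image g := by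
    rintro ⟨e, he⟩ hce
    have hle' := hle _ hce
    have hpos := (G.weight ⟨e, he⟩).pos
    have hmem : ∀ v ∈ e, v ∈ univ.image f ∨ v ∈ univ.image g := fun v hv => by
      have := hle' v hv
      by_contra! hcon
      rw [if_neg hcon.1, if_neg hcon.2] at this
      omega
    have hone : (G.weight ⟨e, he⟩ : ℕ) ≤ 1 := by
      obtain ⟨v, hv⟩ : ∃ v, v ∈ e := by
        induction e with
        | h p q => exact ⟨p, Sym2.mem_mk_left p q⟩
      have := hle' v hv
      rcases hmem v hv with h1 | h1
      · rwa [if_pos h1, if_neg (Finset.disjoint_left.mp hdisj h1)] at this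
      · rwa [if_neg (Finset.disjoint_right.mp hdisj h1), if_pos h1] at this
    induction e with
    | h p q =>
      have hpq : G.graph.Adj p q := he
      rcases hmem p (Sym2.mem_mk_left p q) with hp | hp <;>
        rcases hmem q (Sym2.mem_mk_right p q) with hq | hq
      · left
        intro v hv
        rcases Sym2.mem_iff.mp hv with rfl | rfl <;> assumption
      · exact absurd (hcross p q hp hq hpq) (not_lt.mpr hone)
      · have := hcross q p hq hp hpq.symm
        rw [weight_congr hpq.symm hpq Sym2.eq_swap] at this
        exact absurd this (not_lt.mpr hone)
      · right
        intro v hv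
        rcases Sym2.mem_iff.mp hv with rfl | rfl <;> assumption
  have h1 := two_mul_sum_le (univ.image f) hcb
  have h2 := two_mul_sum_le (univ.image g) hcb
  have hs1 : ∑ v ∈ univ.image f, ((if v ∈ univ.image f then 1 else 0) +
      if v ∈ univ.image g then 1 else 0) = 2 * n + 1 := by
    refine Eq.trans ?_ (card_image_cycle f)
    rw [card_eq_sum_ones]
    exact sum_congr rfl fun v hv => by
      rw [if_pos hv, if_neg (Finset.disjoint_left.mp hdisj hv)]
  have hs2 : ∑ v ∈ univ.image g, ((if v ∈ univ.image f then 1 else 0) +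
      if v ∈ univ.image g then 1 else 0) = 2 * m + 1 := by
    refine Eq.trans ?_ (card_image_cycle g)
    rw [card_eq_sum_ones]
    exact sum_congr rfl fun v hv => by
      rw [if_pos hv, if_neg (Finset.disjoint_right.mp hdisj hv)]
  rw [hs1] at h1
  rw [hs2] at h2
  have h3 : ∑ e, c e ≤
      ∑ e ∈ univ.filter (fun e : G.graph.edgeSet => ∀ v ∈ (e : Sym2 V), v ∈ univ.image f), c e +
      ∑ e ∈ univ.filter (fun e : G.graph.edgeSet => ∀ v ∈ (e : Sym2 V), v ∈ univ.image g), c e := by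
    rw [sum_filter, sum_filter, ← sum_add_distrib]
    refine sum_le_sum fun e _ => ?_
    by_cases hce : c e = 0
    · rw [hce]; exact Nat.zero_le _
    · rcases hsub e hce with h4 | h4
      · rw [if_pos h4]; exact Nat.le_add_right _ _
      · rw [if_pos (c := ∀ v ∈ (e : Sym2 V), v ∈ univ.image g) h4]; exact Nat.le_add_left _ _
  omega

end EdgeWeightedGraph

/-! ### Absence of the configurations, and the two implications -/

namespace EdgeWeightedGraph

open SimpleGraph

/-- The induced subgraphs of `G` avoid the five configurations. -/
def IsForbiddenFree {V : Type*} (G : EdgeWeightedGraph V) : Prop :=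
  ¬ ∃ s : Set V, (G.induce s).IsF1 ∨ (G.induce s).IsF2 ∨ (G.induce s).IsF3 ∨
    (G.induce s).IsF4 ∨ (G.induce s).IsF5

variable {V : Type*} {G : EdgeWeightedGraph V}

namespace IsForbiddenFree

/-- A failure is a copy of `F₂` if `a` and `c` are adjacent, and of `F₁` if they are not. -/
theorem lightAdj (h : G.IsForbiddenFree) {a b c : V} (hac : a ≠ c) (hab : G.HeavyAdj a b)
    (hbc : G.HeavyAdj b c) : G.LightAdj a c := by
  by_contra hno
  have hinj : Function.Injective ![a, b, c] := by
    have h1 := hab.ne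
    have h2 := hbc.ne
    intro i j hij
    fin_cases i <;> fin_cases j <;> simp_all
  by_cases hadj : G.graph.Adj a c
  · have hh : G.HeavyAdj a c := (heavyAdj_or_lightAdj hadj).resolve_right hno
    have hall : ∀ i j, (cycleGraph 3).Adj i j → G.HeavyAdj (![a, b, c] i) (![a, b, c] j) := by
      intro i j hij
      fin_cases i <;> fin_cases j <;>
        first
        | exact absurd rfl hij.ne
        | exact hab
        | exact hab.symm
        | exact hbc
        | exact hbc.symm
        | exact hh
        | exact hh.symm
    obtain ⟨s, hs⟩ := (exists_induce_iso_iff (cycleGraph 3)).mpr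
      ⟨⟨⟨![a, b, c], hinj⟩, fun {i j} => ⟨fun hij => by
        rw [cycleGraph_three_eq_top]
        exact fun heq => hij.ne (congrArg _ heq), fun hij => (hall i j hij).1⟩⟩, hall⟩
    exact h ⟨s, Or.inr (Or.inl hs)⟩
  · have hadj' : ¬ G.graph.Adj c a := fun h => hadj h.symm
    have hall : ∀ i j, (pathGraph 3).Adj i j → G.HeavyAdj (![a, b, c] i) (![a, b, c] j) := by
      intro i j hij
      rw [pathGraph_adj] at hij
      fin_cases i <;> fin_cases j <;>
        first
        | exact hab
        | exact hab.symm
        | exact hbc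
        | exact hbc.symm
        | simp at hij
    obtain ⟨s, hs⟩ := (exists_induce_iso_iff (pathGraph 3)).mpr
      ⟨⟨⟨![a, b, c], hinj⟩, fun {i j} => ⟨fun hij => by
        rw [pathGraph_adj]
        fin_cases i <;> fin_cases j <;>
          first
          | exact absurd rfl hij.ne
          | exact absurd hij hadj
          | exact absurd hij hadj'
          | simp, fun hij => (hall i j hij).1⟩⟩, hall⟩
    exact h ⟨s, Or.inl hs⟩

/-- If `u a` is heavy, it forms a heavy path with `a b`, and the light edge goes to `b` instead.
Thus any edge to one end of a heavy edge can be traded for a light one. -/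
theorem exists_lightAdj_of_adj (h : G.IsForbiddenFree) {u a b : V} (hua : G.graph.Adj u a)
    (hub : u ≠ b) (hab : G.HeavyAdj a b) : ∃ x ∈ s(a, b), G.LightAdj u x := by
  rcases heavyAdj_or_lightAdj hua with hh | hl
  · exact ⟨b, Sym2.mem_mk_right a b, h.lightAdj hub hh hab⟩
  · exact ⟨a, Sym2.mem_mk_left a b, hl⟩

theorem exists_adj (h : G.IsForbiddenFree) {a b c d : V} (hab : G.HeavyAdj a b)
    (hcd : G.HeavyAdj c d) (hac : a ≠ c) (had : a ≠ d) (hbc : b ≠ c) (hbd : b ≠ d) :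
    G.graph.Adj a c ∨ G.graph.Adj a d ∨ G.graph.Adj b c ∨ G.graph.Adj b d := by
  by_contra! hno
  obtain ⟨h1, h2, h3, h4⟩ := hno
  have hinj : Function.Injective (Sum.elim ![a, b] ![c, d]) := by
    have h5 := hab.ne
    have h6 := hcd.ne
    rintro (i | i) (j | j) hij <;> fin_cases i <;> fin_cases j <;> simp_all
  have hall : ∀ i j, (pathGraph 2 ⊕g pathGraph 2).Adj i j →
      G.HeavyAdj (Sum.elim ![a, b] ![c, d] i) (Sum.elim ![a, b] ![c, d] j) := by
    rintro (i | i) (j | j) hij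
    · fin_cases i <;> fin_cases j <;>
        first
        | exact hab
        | exact hab.symm
        | exact absurd rfl hij.ne
    · simp at hij
    · simp at hij
    · fin_cases i <;> fin_cases j <;>
        first
        | exact hcd
        | exact hcd.symm
        | exact absurd rfl hij.ne
  have hcross : ∀ i j, ¬ G.graph.Adj (![a, b] i) (![c, d] j) := by
    intro i j
    fin_cases i <;> fin_cases j <;> assumption
  obtain ⟨s, hs⟩ := (exists_induce_iso_iff (pathGraph 2 ⊕g pathGraph 2)).mpr
    ⟨⟨⟨Sum.elim ![a, b] ![c, d], hinj⟩, fun {i j} => ⟨fun hij => by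
      rcases i with i | i <;> rcases j with j | j
      · have hne : i ≠ j := fun heq => hij.ne (by rw [heq])
        change (pathGraph 2).Adj i j
        rw [pathGraph_adj]
        omega
      · exact absurd hij (hcross i j)
      · exact absurd hij.symm (hcross j i)
      · have hne : i ≠ j := fun heq => hij.ne (by rw [heq])
        change (pathGraph 2).Adj i j
        rw [pathGraph_adj]
        omega, fun hij => (hall i j hij).1⟩⟩, hall⟩
  exact h ⟨s, Or.inr (Or.inr (Or.inl hs))⟩

/-- Heavy edges with a common vertex form a heavy path. Disjoint ones are joined by some edge, as
`F₃` is absent, and that edge can be traded for a light one. -/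
theorem exists_lightAdj_of_heavy (h : G.IsForbiddenFree) {a b c d : V} (hab : G.HeavyAdj a b)
    (hcd : G.HeavyAdj c d) (hne : s(a, b) ≠ s(c, d)) :
    ∃ x ∈ s(a, b), ∃ y ∈ s(c, d), G.LightAdj x y := by
  have hshare : ∀ {p q r : V}, s(p, q) ≠ s(q, r) → G.HeavyAdj p q → G.HeavyAdj q r →
      G.LightAdj p r := fun {p q r} hne h1 h2 =>
    h.lightAdj (fun heq => hne (by rw [heq]; exact Sym2.eq_swap)) h1 h2
  by_cases hac : a = c
  · subst hac
    exact ⟨b, by simp, d, by simp, hshare (by rwa [Sym2.eq_swap]) hab.symm hcd⟩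
  by_cases had : a = d
  · subst had
    exact ⟨b, by simp, c, by simp, hshare (by rwa [Sym2.eq_swap, @Sym2.eq_swap _ a c])
      hab.symm hcd.symm⟩
  by_cases hbc : b = c
  · subst hbc
    exact ⟨a, by simp, d, by simp, hshare hne hab hcd⟩
  by_cases hbd : b = d
  · subst hbd
    exact ⟨a, by simp, c, by simp, hshare (by rwa [@Sym2.eq_swap _ b c]) hab hcd.symm⟩
  rcases h.exists_adj hab hcd hac had hbc hbd with hadj | hadj | hadj | hadj
  · obtain ⟨y, hy, hl⟩ := h.exists_lightAdj_of_adj hadj had hcd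
    exact ⟨a, by simp, y, hy, hl⟩
  · obtain ⟨y, hy, hl⟩ := h.exists_lightAdj_of_adj hadj hac hcd.symm
    exact ⟨a, by simp, y, by rwa [Sym2.eq_swap], hl⟩
  · obtain ⟨y, hy, hl⟩ := h.exists_lightAdj_of_adj hadj hbd hcd
    exact ⟨b, by simp, y, hy, hl⟩
  · obtain ⟨y, hy, hl⟩ := h.exists_lightAdj_of_adj hadj hbc hcd.symm
    exact ⟨b, by simp, y, by rwa [Sym2.eq_swap], hl⟩

/-- An odd set contains an induced odd cycle, so a missing light connection would exhibit an induced
`F₄` or `F₅`. -/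
theorem hasLightConnections [Fintype V] [Fintype G.graph.edgeSet] (h : G.IsForbiddenFree) :
    HasLightConnections (fun e : G.graph.edgeSet => (e : Sym2 V))
      (fun e => (G.weight e : ℕ)) where
  heavy_heavy := by
    rintro ⟨e, he⟩ ⟨f, hf⟩ hwe hwf hef
    induction e with
    | h a b =>
      induction f with
      | h c d =>
        obtain ⟨x, hx, y, hy, hl, hw⟩ := h.exists_lightAdj_of_heavy (a := a) (b := b) (c := c)
          (d := d) ⟨he, hwe⟩ ⟨hf, hwf⟩ (fun heq => hef (Subtype.ext heq))
        exact ⟨x, hx, y, hy, ⟨s(x, y), hl⟩, hw, rfl⟩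
  odd_heavy := by
    rintro U hU ⟨e, he⟩ hwe hdisj
    obtain ⟨n, hn, f, hf⟩ := hU.exists_cycle
    induction e with
    | h a b =>
      have hab : G.HeavyAdj a b := ⟨he, hwe⟩
      have hfa : ∀ i, f i ≠ a := fun i hi => hdisj a (Sym2.mem_mk_left a b) (hi ▸ hf i)
      have hfb : ∀ i, f i ≠ b := fun i hi => hdisj b (Sym2.mem_mk_right a b) (hi ▸ hf i)
      by_cases hno : ∃ i, G.graph.Adj (f i) a ∨ G.graph.Adj (f i) b
      · obtain ⟨i, hi | hi⟩ := hno
        · obtain ⟨x, hx, hl, hw⟩ := h.exists_lightAdj_of_adj hi (hfb i) hab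
          exact ⟨f i, hf i, x, hx, ⟨s(f i, x), hl⟩, hw, rfl⟩
        · obtain ⟨x, hx, hl, hw⟩ := h.exists_lightAdj_of_adj hi (hfa i) hab.symm
          exact ⟨f i, hf i, x, by rwa [Sym2.eq_swap] at hx, ⟨s(f i, x), hl⟩, hw, rfl⟩
      · push Not at hno
        obtain ⟨s, hs⟩ := exists_isF4_iff.mpr
          ⟨n, hn, f, a, b, hab, fun i => ⟨hfa i, hfb i, hno i⟩⟩
        exact absurd ⟨s, Or.inr (Or.inr (Or.inr (Or.inl hs)))⟩ h
  odd_odd := by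
    intro U U' hU hU' hdisj
    obtain ⟨n, hn, f, hf⟩ := hU.exists_cycle
    obtain ⟨m, hm, g, hg⟩ := hU'.exists_cycle
    by_contra! hno
    obtain ⟨s, hs⟩ := exists_isF5_iff.mpr ⟨n, m, hn, hm, f, g, fun i j =>
      ⟨fun heq => Set.disjoint_left.mp hdisj (hf i) (heq ▸ hg j), fun hadj =>
        (heavyAdj_or_lightAdj hadj).resolve_right fun ⟨hl, hw⟩ =>
          hno (f i) (hf i) (g j) (hg j) ⟨s(f i, g j), hl⟩ hw rfl⟩⟩
    exact h ⟨s, Or.inr (Or.inr (Or.inr (Or.inr hs)))⟩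

theorem isNormalIdeal [Fintype V] (h : G.IsForbiddenFree) (k : Type*) [Field k] :
    IsNormalIdeal (G.edgeIdeal k) := by
  classical
  intro t _
  ext r
  constructor
  · intro hr
    refine ⟨1, le_rfl, fun _ => -r, fun i hi => ?_, by simp⟩
    rw [Finset.mem_Icc] at hi
    rw [show i = 1 by omega, pow_one]
    exact neg_mem hr
  · intro hr
    change IsIntegralOverIdeal _ _ at hr
    rw [edgeIdeal_eq] at hr ⊢
    refine mem_monomialIdeal_pow_of_le fun b hb => ?_
    obtain ⟨c, hc, hct, hcb⟩ := hr.mem_newtonPolyhedron hb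
    have hexp : ∀ (e : G.graph.edgeSet) v, (G.edgeExponent e v) =
        if v ∈ (e : Sym2 V) then (G.weight e : ℕ) else 0 := fun e v => by
      split_ifs with hv
      · exact edgeExponent_of_mem hv
      · exact edgeExponent_of_notMem hv
    -- Multiplying the coefficients by the weights turns exponents into vertex loads and the sum of
    -- the coefficients into `weightedSize`.
    obtain ⟨n, hn, hnb⟩ := h.hasLightConnections.exists_packing (a := b)
      (y₀ := fun e => (G.weight e : ℕ) * c e) (t := t)
      (fun e => G.graph.not_isDiag_of_mem_edgeSet e.2) (fun e => (G.weight e).pos)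
      ⟨fun e => mul_nonneg (Nat.cast_nonneg _) (hc e), fun v => by
        rw [vertexLoad_apply]
        refine le_trans (le_of_eq (Finset.sum_congr rfl fun e _ => ?_)) (hcb v)
        rw [hexp]
        split_ifs
        · rw [mul_comm]
        · simp⟩
      (by
        rw [weightedSize_apply, ← hct]
        refine le_of_eq (Finset.sum_congr rfl fun e _ => ?_)
        have : ((G.weight e : ℕ) : ℝ) ≠ 0 := by exact_mod_cast (G.weight e).ne_zero
        field_simp)
    refine ⟨n, hn, fun v => le_trans (le_of_eq ?_) (hnb v)⟩
    rw [Finsupp.finsetSum_apply]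
    refine Finset.sum_congr rfl fun e _ => ?_
    rw [Finsupp.smul_apply, hexp, smul_eq_mul]
    split_ifs
    · rw [mul_comm]
    · simp

end IsForbiddenFree

theorem isForbiddenFree_of_normal [Fintype V] {k : Type*} [Field k]
    (h : IsNormalIdeal (G.edgeIdeal k)) : G.IsForbiddenFree := by
  rintro ⟨s, h1 | h2 | h3 | h4 | h5⟩
  · obtain ⟨f, hf⟩ := (exists_induce_iso_iff (pathGraph 3)).mp ⟨s, h1⟩
    have h01 : (pathGraph 3).Adj 0 1 := by simp [pathGraph_adj]
    have h12 : (pathGraph 3).Adj 1 2 := by simp [pathGraph_adj]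
    obtain ⟨hadj, -⟩ := lightAdj_of_normal h (f.injective.ne (by decide)) (hf 0 1 h01) (hf 1 2 h12)
    have := f.map_adj_iff.mp hadj
    simp [pathGraph_adj] at this
  · obtain ⟨f, hf⟩ := (exists_induce_iso_iff (cycleGraph 3)).mp ⟨s, h2⟩
    have htop : ∀ i j, i ≠ j → (cycleGraph 3).Adj i j := fun i j hij => by
      rw [cycleGraph_three_eq_top]
      exact hij
    exact (hf 0 2 (htop 0 2 (by decide))).not_lightAdj
      (lightAdj_of_normal h (f.injective.ne (by decide)) (hf 0 1 (htop 0 1 (by decide)))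
        (hf 1 2 (htop 1 2 (by decide))))
  · obtain ⟨f, hf⟩ := (exists_induce_iso_iff (pathGraph 2 ⊕g pathGraph 2)).mp ⟨s, h3⟩
    have hcross : ∀ i j, ¬ G.graph.Adj (f (Sum.inl i)) (f (Sum.inr j)) := fun i j hij => by
      have := f.map_adj_iff.mp hij
      simp at this
    have hne : ∀ i j, f (Sum.inl i) ≠ f (Sum.inr j) := fun i j => f.injective.ne (by simp)
    have := exists_adj_of_normal h
      (hf (Sum.inl 0) (Sum.inl 1) (by simp [pathGraph_adj]))
      (hf (Sum.inr 0) (Sum.inr 1) (by simp [pathGraph_adj]))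
      (hne 0 0) (hne 0 1) (hne 1 0) (hne 1 1)
    simp only [hcross, or_self] at this
  · obtain ⟨n, hn, f, a, b, hab, hf⟩ := exists_isF4_iff.mp ⟨s, h4⟩
    obtain ⟨i, hi⟩ := exists_cycle_adj_of_normal h hn f hab fun i => ⟨(hf i).1, (hf i).2.1⟩
    have := (hf i).2.2
    tauto
  · obtain ⟨n, m, hn, hm, f, g, hfg⟩ := exists_isF5_iff.mp ⟨s, h5⟩
    exact not_two_cycles_of_normal h hn hm f g hfg

end EdgeWeightedGraph

theorem theorem1p1 {k : Type*} [Field k] {V : Type*} [Finite V] (G : EdgeWeightedGraph V) :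
    IsNormalIdeal (G.edgeIdeal k) ↔
      ¬ ∃ s : Set V, (G.induce s).IsF1 ∨ (G.induce s).IsF2 ∨ (G.induce s).IsF3 ∨
        (G.induce s).IsF4 ∨ (G.induce s).IsF5 := by
  have := Fintype.ofFinite V
  exact ⟨EdgeWeightedGraph.isForbiddenFree_of_normal,
    fun h => EdgeWeightedGraph.IsForbiddenFree.isNormalIdeal h k⟩
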